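/- A signed group is a group $S$ with a distinguished central element of order two, denoted $-1$. A remrep of degree $m$ of $S$ is a group homomorphism $\pi$ from $S$ to the group $SP_m$ of $m\times m$ signed permutation matrices (entries in $\{0,\pm1\}$, exactly one nonzero entry in each row and each column) with $\pi(-1)=-I_m$. For a ring $R$, the signed group ring $R[S]$ is the group ring of $S$ over $R$ modulo the identification $r(-s)=-(rs)$. Let $x_1,\dots,x_k$ be commuting real variables, which also commute with $S$. Consider square matrices $X=[a_{ij}]$ each of whose entries is $0$ or of the form $\epsilon x_\ell$ with $\epsilon\in S$ and $1\le\ell\le k$. Put $\overline{\epsilon x_\ell}=\epsilon^{-1}x_\ell$, $|\epsilon x_\ell|=x_\ell$, $\overline 0=|0|=0$ and $X^*=[\overline{a_{ji}}]$. For positive integers $w_1,\dots,w_k$, such a matrix $X$ of order $N$ is a signed group orthogonal design $SOD(N;\,w_1,\dots,w_k)$ over $S$ if $XX^*=\bigl(\sum_{i=1}^k w_ix_i^2\bigr)I_N$ over the signed group ring of $S$ with coefficients in $\mathbb R[x_1,\dots,x_k]$. It is full if it has no zero entry, circulant if each row is the cyclic right shift by one place of the preceding row, and quasisymmetric if $|a_{ij}|=|\overline{a_{ji}}|$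 for all $i,j$. **Theorem.** Let $k\ge 1$, let $u_1,\dots,u_k$ be positive integers and let $u=u_1+\cdots+u_k$. Then there exist a signed group $S$, a non-negative integer $n$ and a full circulant quasisymmetric $SOD(4u;\,4u_1,4u_2,\dots,4u_k)$ over $S$ such that $S$ admits a remrep of degree $2^n$ and $$n\le \tfrac{3}{13}\log_2(u_1-1)+\tfrac{3}{13}\sum_{i=2}^k\log_2 u_i+8k+2,$$ where $\log_2 0$ is read as $0$. -/

import Mathlib

/-- A signed group: a group with a distinguished central element `-1` of order two. -/
class SignedGroup (S : Type*) extends Group S where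
  /-- The distinguished element `-1`. -/
  negOne : S
  negOne_central : negOne ∈ Subgroup.center S
  negOne_order : orderOf negOne = 2

namespace SignedGroup

/-- The matrices in `SP_m`: square `{0, 1, -1}`-matrices with exactly one nonzero entry in each
row and in each column. -/
def IsSignedPerm {m : ℕ} (M : Matrix (Fin m) (Fin m) ℝ) : Prop :=
  (∀ i j, M i j = 0 ∨ M i j = 1 ∨ M i j = -1) ∧
    (∀ i, ∃! j, M i j ≠ 0) ∧ (∀ j, ∃! i, M i j ≠ 0)

/-- A remrep (real monomial representation) of degree `m` of a signed group `S`: a multiplicative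
map from `S` to the signed permutation matrices of order `m` which sends `-1` to `-I`. -/
structure Remrep (S : Type*) [SignedGroup S] (m : ℕ) extends
    S →* Matrix (Fin m) (Fin m) ℝ where
  isSignedPerm : ∀ s, IsSignedPerm (toFun s)
  map_negOne : toFun negOne = -1

/-- The identification `r (-s) = -(r s)` that defines the signed group ring. -/
inductive RingRel (R S : Type*) [Ring R] [SignedGroup S] :
    MonoidAlgebra R S → MonoidAlgebra R S → Prop
  | neg (r : R) (s : S) :
      RingRel R S (MonoidAlgebra.single (negOne * s) r) (-MonoidAlgebra.single s r)

/-- The signed group ring `R[S]`: the group ring of `S` over `R` modulo `r (-s) = -(r s)`.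
It is the free `R`-module on representatives of `S / ⟨-1⟩`. -/
abbrev SignedGroupRing (R S : Type*) [Ring R] [SignedGroup S] : Type _ :=
  RingQuot (RingRel R S)

/-- The element `r s` of the signed group ring `R[S]`. -/
noncomputable def monom {R S : Type*} [Ring R] [SignedGroup S] (r : R) (s : S) :
    SignedGroupRing R S :=
  RingQuot.mkRingHom (RingRel R S) (MonoidAlgebra.single s r)

/-- An entry: `0` or a signed variable `ε x_ℓ` with `ε ∈ S`, among the variables `x_ℓ`
indexed by `ℓ : Fin k`. -/
inductive Entry (S : Type*) (k : ℕ)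
  | zero : Entry S k
  | term (ε : S) (l : Fin k) : Entry S k

namespace Entry

variable {S : Type*} {k : ℕ}

/-- The conjugate: `0` and `ε⁻¹ x_ℓ` for `0` and `ε x_ℓ`. -/
def conj [SignedGroup S] : Entry S k → Entry S k
  | zero => zero
  | term ε l => term ε⁻¹ l

/-- The absolute value: `0` for `0`, and the variable `x_ℓ` for `ε x_ℓ`. -/
def abs : Entry S k → Option (Fin k)
  | zero => none
  | term _ l => some l

/-- The entry as an element of the signed group ring of `S` over the polynomial ring
`ℝ[x_1, …, x_k]`; the variables are central. -/
noncomputable def toRing [SignedGroup S] :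
    Entry S k → SignedGroupRing (MvPolynomial (Fin k) ℝ) S
  | zero => 0
  | term ε l => monom (MvPolynomial.X l) ε

end Entry

/-- The adjoint `A^*`: the conjugate transpose. -/
def adjoint {S : Type*} [SignedGroup S] {n k : ℕ} (A : Matrix (Fin n) (Fin n) (Entry S k)) :
    Matrix (Fin n) (Fin n) (Entry S k) :=
  (A.map Entry.conj).transpose

/-- `A` is quasisymmetric: `abs(A) = abs(A^*)`. -/
def IsQuasisymmetric {S : Type*} [SignedGroup S] {n k : ℕ}
    (A : Matrix (Fin n) (Fin n) (Entry S k)) : Prop :=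
  A.map Entry.abs = (adjoint A).map Entry.abs

/-- `A = circ(a_0, …, a_{n-1})` for some `a`: each row is the previous one shifted cyclically to
the right (subtraction in `Fin n` is modulo `n`). -/
def IsCirculant {S : Type*} {n k : ℕ} (A : Matrix (Fin n) (Fin n) (Entry S k)) : Prop :=
  ∃ a : Fin n → Entry S k, ∀ i j, A i j = a (j - i)

/-- `A` has no zero entries. -/
def IsFull {S : Type*} {n k : ℕ} (A : Matrix (Fin n) (Fin n) (Entry S k)) : Prop :=
  ∀ i j, A i j ≠ Entry.zero

/-- `A` is a signed group orthogonal design `SOD(n; u_1, …, u_k)` over `S`: the `u_i` are positive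
and `A A^* = (∑ u_i x_i²) I_n`. -/
def IsSOD {S : Type*} [SignedGroup S] {n k : ℕ} (A : Matrix (Fin n) (Fin n) (Entry S k))
    (u : Fin k → ℕ) : Prop :=
  (∀ i, 0 < u i) ∧
    A.map Entry.toRing * (adjoint A).map Entry.toRing =
      Matrix.diagonal fun _ => monom (∑ i, (u i : MvPolynomial (Fin k) ℝ) * MvPolynomial.X i ^ 2) 1

end SignedGroup

/-!
A design is built whose first row `a` is Hermitian, `a (-t) = conj (a t)`. Its circulant matrix `X`
is then quasisymmetric and equal to its adjoint, so `X X*` is the circulant matrix of the square of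
`a` in the group ring of the cyclic group of order `4u` over the signed group ring.

The signed group is the Pauli group on `m` qubits, with the scalars `±1, ±I`. By the Jordan-Wigner
construction it contains anticommuting elements `E_j`, `F_j` (`j < m`) with `E_j² = 1` and
`F_j² = -1`, and it has a remrep of degree `2 ^ (m + 1)`. Let `z` be the cyclic shift and
`J = z ^ (2u)`. A sequence over the fourth roots of unity, placed in an interval of positions, has a
polynomial `α` with adjoint `α*`, and the term `x ((α + α*) E_j + J (α - α*) F_j)` occupies the
orbits of the interval under `t ↦ -t` and `t ↦ t + 2u`. Its square is
`x² ((α + α*)² - (α - α*)²) = 4 x² α α*`, and the terms of different sequences anticommute, having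
different `j`. The orbits of `0` and `u` are left over; they carry
`x ((1 - J) E_0 + (z ^ u + z ^ (-u)) I F_0)`, of square `4 x²` (`add_slotSum_sq`). Hence a design
results whenever the `u_1 - 1`, respectively `u_i`, orbits available for each variable are filled by
sequences whose autocorrelations cancel (`exists_design`), and `n` is `2` plus the number of
sequences. All cancellation takes place in the signed group ring itself, not only in a
representation.

It remains to find, for every `v`, a complementary family of at most `(3 / 13) log₂ v + 8` sequences
of total length `v` (`exists_isComplementary`). A complex Golay pair of length `c` supplies two
sequences of total length `2c`, so it suffices to write `⌊v / 2⌋` as a sum of few lengths of such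
pairs; if `v` is odd, one sequence of length `1` is added. There are pairs of lengths `1, 3, 5, 11, 13`, and lengths `c`, `d` give the length `2 c d`.
Evaluating bit masks in the kernel shows that every number below `2 ^ 13` is a sum of three lengths,
and that every number in `[2 ^ b, 2 ^ b')` exceeds some length by less than `2 ^ b`, where `(b, b')`
is `(13, 19)`, `(19, 26)`, `(26, 34)` or `(34, 43)`. As lengths may be doubled, the last gap bound
persists at all larger scales, so each further summand gains nine bits, which is more than the
`26 / 3` bits required.
-/

/-! ### Quaternary sequences and complex Golay pairs -/

/-- The value at `z` of the quaternary sequence `(I ^ a₀, I ^ a₁, …)`, that is, of the polynomial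
`∑ I ^ aₜ z ^ t`. A sequence over the fourth roots of unity is recorded by its exponents, and
`I` is any element of square `-1`. -/
def seqEval {K : Type*} [CommRing K] (I z : K) : List ℕ → K
  | [] => 0
  | a :: l => I ^ a + z * seqEval I z l

section seqEval

variable {K : Type*} [CommRing K] {I z w : K}

theorem seqEval_append (I z : K) (l m : List ℕ) :
    seqEval I z (l ++ m) = seqEval I z l + z ^ l.length * seqEval I z m := by
  induction l with
  | nil => simp [seqEval]
  | cons a l ih => simp only [List.cons_append, seqEval, ih, List.length_cons]; ring

theorem seqEval_map_add (I z : K) (c : ℕ) (l : List ℕ) :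
    seqEval I z (l.map (c + ·)) = I ^ c * seqEval I z l := by
  induction l with
  | nil => simp [seqEval]
  | cons a l ih => simp only [List.map_cons, seqEval, ih]; ring

theorem neg_pow_of_sq_eq_neg_one (hI : I ^ 2 = -1) (a : ℕ) : (-I) ^ a = I ^ (3 * a) := by
  have h : -I = I ^ 3 := by linear_combination -I * hI
  rw [h, pow_mul]

/-- The reversed conjugate of a quaternary sequence. -/
def conjRev (l : List ℕ) : List ℕ := (l.map (3 * ·)).reverse

theorem length_conjRev (l : List ℕ) : (conjRev l).length = l.length := by simp [conjRev]

/-- The reversed conjugate of a polynomial `A` of length `k` is `z ^ (k - 1)` times its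
adjoint. -/
theorem mul_seqEval_conjRev (hI : I ^ 2 = -1) (hz : z * w = 1) (l : List ℕ) :
    z * seqEval I z (conjRev l) = z ^ l.length * seqEval (-I) w l := by
  induction l with
  | nil => simp [seqEval, conjRev]
  | cons a l ih =>
    have h : conjRev (a :: l) = conjRev l ++ [3 * a] := by simp [conjRev]
    rw [h, seqEval_append, mul_add, ih, length_conjRev]
    simp only [seqEval, List.length_cons, neg_pow_of_sq_eq_neg_one hI]
    linear_combination (-z ^ l.length * seqEval (-I) w l) * hz

end seqEval

/-- `a` and `b` form a complex Golay pair of length `n`: two sequences over the fourth roots of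
unity whose aperiodic autocorrelations add up to zero. The condition is stated as the norm identity
`|A|² + |B|² = 2 n` for the associated polynomials, where `w` plays the role of `z⁻¹` and `-I` that
of the complex conjugate of `I`. -/
structure IsGolayPair (n : ℕ) (a b : List ℕ) : Prop where
  length_left : a.length = n
  length_right : b.length = n
  norm_add_norm : ∀ {K : Type} [CommRing K] (I z w : K), I ^ 2 = -1 → z * w = 1 →
    seqEval I z a * seqEval (-I) w a + seqEval I z b * seqEval (-I) w b = 2 * (n : K)

/-- There is a complex Golay pair of length `n`. -/
def IsGolayNumber (n : ℕ) : Prop := ∃ a b, IsGolayPair n a b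

/-- The norm identity may be checked after clearing the negative powers of `z`. -/
theorem IsGolayPair.of_conjRev {n : ℕ} {a b : List ℕ} (ha : a.length = n + 1)
    (hb : b.length = n + 1)
    (h : ∀ {K : Type} [CommRing K] (I z : K), I ^ 2 = -1 →
      seqEval I z a * seqEval I z (conjRev a) + seqEval I z b * seqEval I z (conjRev b) =
        2 * ((n + 1 : ℕ) : K) * z ^ n) :
    IsGolayPair (n + 1) a b := by
  refine ⟨ha, hb, fun {K} _ I z w hI hz => ?_⟩
  have h1 := mul_seqEval_conjRev hI hz a
  have h2 := mul_seqEval_conjRev hI hz b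
  rw [ha] at h1
  rw [hb] at h2
  have h3 := h I z hI
  have hzw : z ^ (n + 1) * w ^ (n + 1) = 1 := by rw [← mul_pow, hz, one_pow]
  have key : z ^ (n + 1) * (seqEval I z a * seqEval (-I) w a + seqEval I z b * seqEval (-I) w b)
      = z ^ (n + 1) * (2 * ((n + 1 : ℕ) : K)) := by
    linear_combination z * h3 - seqEval I z a * h1 - seqEval I z b * h2
  calc _ = (z ^ (n + 1) * w ^ (n + 1)) *
        (seqEval I z a * seqEval (-I) w a + seqEval I z b * seqEval (-I) w b) := by
        rw [hzw, one_mul]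
    _ = w ^ (n + 1) * (z ^ (n + 1) *
        (seqEval I z a * seqEval (-I) w a + seqEval I z b * seqEval (-I) w b)) := by ring
    _ = (z ^ (n + 1) * w ^ (n + 1)) * (2 * ((n + 1 : ℕ) : K)) := by rw [key]; ring
    _ = _ := by rw [hzw, one_mul]

theorem isGolayNumber_one : IsGolayNumber 1 := by
  refine ⟨[0], [0], IsGolayPair.of_conjRev rfl rfl fun I z hI => ?_⟩
  simp [conjRev, seqEval]
  norm_num

/-- The two sequences, of exponents of `I`, are the Golay pair. After reduction of the powers of `I`
the autocorrelation sum is `c₀ + c₂ I²` with real polynomials `c₀`, `c₂`, and the coefficient of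
`hI` is `c₂`, the sum of the products of the imaginary parts with their reversed conjugates. The pairs of
lengths `5`, `11`, `13` are verified in the same way. -/
theorem isGolayNumber_three : IsGolayNumber 3 := by
  refine ⟨[0, 0, 2], [0, 1, 0],
    IsGolayPair.of_conjRev rfl rfl fun I z hI => ?_⟩
  have h3 : I ^ 3 = -I := by linear_combination I * hI
  have h6 : I ^ 6 = -1 := by linear_combination (I ^ 4 - I ^ 2 + 1) * hI
  simp [conjRev, seqEval, hI, h3, h6]
  linear_combination ((z) * (- z)) * hI

theorem isGolayNumber_five : IsGolayNumber 5 := by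
  refine ⟨[0, 0, 0, 1, 3], [0, 3, 2, 0, 1],
    IsGolayPair.of_conjRev rfl rfl fun I z hI => ?_⟩
  have h3 : I ^ 3 = -I := by linear_combination I * hI
  have h6 : I ^ 6 = -1 := by linear_combination (I ^ 4 - I ^ 2 + 1) * hI
  have h9 : I ^ 9 = I := by linear_combination I * (I ^ 6 - I ^ 4 + I ^ 2 - 1) * hI
  simp [conjRev, seqEval, hI, h3, h6, h9]
  linear_combination ((z ^ 3 - z ^ 4) * (1 - z) +
    (- z + z ^ 4) * (- 1 + z ^ 3)) * hI

theorem isGolayNumber_eleven : IsGolayNumber 11 := by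
  refine ⟨[0, 0, 3, 3, 3, 0, 0, 1, 2, 0, 2], [0, 1, 2, 0, 2, 1, 3, 2, 1, 1, 0],
    IsGolayPair.of_conjRev rfl rfl fun I z hI => ?_⟩
  have h3 : I ^ 3 = -I := by linear_combination I * hI
  have h6 : I ^ 6 = -1 := by linear_combination (I ^ 4 - I ^ 2 + 1) * hI
  have h9 : I ^ 9 = I := by linear_combination I * (I ^ 6 - I ^ 4 + I ^ 2 - 1) * hI
  simp [conjRev, seqEval, hI, h3, h6, h9]
  linear_combination ((- z ^ 2 - z ^ 3 - z ^ 4 + z ^ 7) * (- z ^ 3 + z ^ 6 + z ^ 7 + z ^ 8) +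
    (z + z ^ 5 - z ^ 6 + z ^ 8 + z ^ 9) * (- z - z ^ 2 + z ^ 4 - z ^ 5 - z ^ 9)) * hI

theorem isGolayNumber_thirteen : IsGolayNumber 13 := by
  refine ⟨[0, 0, 0, 3, 2, 0, 0, 1, 0, 2, 0, 1, 3], [0, 3, 2, 2, 2, 3, 2, 0, 0, 1, 2, 0, 1],
    IsGolayPair.of_conjRev rfl rfl fun I z hI => ?_⟩
  have h3 : I ^ 3 = -I := by linear_combination I * hI
  have h6 : I ^ 6 = -1 := by linear_combination (I ^ 4 - I ^ 2 + 1) * hI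
  have h9 : I ^ 9 = I := by linear_combination I * (I ^ 6 - I ^ 4 + I ^ 2 - 1) * hI
  simp [conjRev, seqEval, hI, h3, h6, h9]
  linear_combination ((- z ^ 3 + z ^ 7 + z ^ 11 - z ^ 12) * (1 - z - z ^ 5 + z ^ 9) +
    (- z - z ^ 5 + z ^ 9 + z ^ 12) * (- 1 - z ^ 3 + z ^ 7 + z ^ 11)) * hI

/-- Replaces each pair of corresponding entries `(I ^ x, I ^ y)` of `a`, `b` by the block
`I ^ x p, I ^ y q`. -/
def interleave (p q : List ℕ) : List ℕ → List ℕ → List ℕ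
  | x :: a, y :: b => (p.map (x + ·)) ++ (q.map (y + ·)) ++ interleave p q a b
  | _, _ => []

theorem seqEval_interleave {K : Type*} [CommRing K] (I z : K) {p q : List ℕ} {n : ℕ}
    (hp : p.length = n) (hq : q.length = n) :
    ∀ {a b : List ℕ}, a.length = b.length → seqEval I z (interleave p q a b) =
      seqEval I (z ^ (2 * n)) a * seqEval I z p + z ^ n * seqEval I (z ^ (2 * n)) b * seqEval I z q
  | [], [], _ => by simp [interleave, seqEval]
  | x :: a, y :: b, h => by
    have ih := seqEval_interleave I z hp hq (a := a) (b := b) (by simpa using h)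
    simp only [interleave, seqEval_append, seqEval_map_add, ih, seqEval, List.length_append,
      List.length_map, hp, hq]
    ring

theorem length_interleave {p q : List ℕ} {n : ℕ} (hp : p.length = n) (hq : q.length = n) :
    ∀ {a b : List ℕ}, a.length = b.length → (interleave p q a b).length = 2 * a.length * n
  | [], [], _ => by simp [interleave]
  | x :: a, y :: b, h => by
    have ih := length_interleave hp hq (a := a) (b := b) (by simpa using h)
    simp only [interleave, List.length_append, List.length_map, hp, hq, ih, List.length_cons]
    ring

/-- From Golay pairs `(A, B)` of length `m` and `(P, Q)` of length `n` one gets the Golay pair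
`A(z²ⁿ) P + zⁿ B(z²ⁿ) Q`, `B~(z²ⁿ) P - zⁿ A~(z²ⁿ) Q` of length `2 m n`, where `~` is the reversed
conjugate. -/
theorem IsGolayNumber.two_mul_mul {m n : ℕ} (hm : IsGolayNumber m) (hn : IsGolayNumber n) :
    IsGolayNumber (2 * m * n) := by
  obtain ⟨a, b, hab⟩ := hm
  obtain ⟨p, q, hpq⟩ := hn
  have la := hab.length_left
  have lb := hab.length_right
  have lp := hpq.length_left
  have lq := hpq.length_right
  have l1 : a.length = b.length := by rw [la, lb]
  have l2 : (conjRev b).length = ((conjRev a).map (2 + ·)).length := by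
    simp [length_conjRev, la, lb]
  refine ⟨interleave p q a b, interleave p q (conjRev b) ((conjRev a).map (2 + ·)),
    by rw [length_interleave lp lq l1, la], by rw [length_interleave lp lq l2, length_conjRev, lb],
    fun {K} _ I z w hI hz => ?_⟩
  have hI' : (-I) ^ 2 = -1 := by rw [neg_sq, hI]
  have hwz : w * z = 1 := by rw [mul_comm, hz]
  have hZ : z ^ (2 * n) * w ^ (2 * n) = 1 := by rw [← mul_pow, hz, one_pow]
  have hZ' : w ^ (2 * n) * z ^ (2 * n) = 1 := by rw [mul_comm, hZ]
  have hzn : z ^ n * w ^ n = 1 := by rw [← mul_pow, hz, one_pow]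
  simp only [seqEval_interleave _ _ lp lq l1, seqEval_interleave _ _ lp lq l2, seqEval_map_add,
    hI, hI']
  have n1 := hab.norm_add_norm I (z ^ (2 * n)) (w ^ (2 * n)) hI hZ
  have n2 := hpq.norm_add_norm I z w hI hz
  have ra := mul_seqEval_conjRev hI hZ a
  have rb := mul_seqEval_conjRev hI hZ b
  have ra' := mul_seqEval_conjRev hI' hZ' a
  have rb' := mul_seqEval_conjRev hI' hZ' b
  rw [la] at ra ra'
  rw [lb] at rb rb'
  rw [neg_neg] at ra' rb'
  have hZm : (z ^ (2 * n)) ^ m * (w ^ (2 * n)) ^ m = 1 := by rw [← mul_pow, hZ, one_pow]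
  generalize z ^ (2 * n) = Z at *
  generalize w ^ (2 * n) = W at *
  generalize z ^ n = x at *
  generalize w ^ n = y at *
  generalize Z ^ m = Zm at *
  generalize W ^ m = Wm at *
  generalize seqEval I Z a = A at *
  generalize seqEval I Z b = B at *
  generalize seqEval (-I) W a = A' at *
  generalize seqEval (-I) W b = B' at *
  generalize seqEval I Z (conjRev a) = C at *
  generalize seqEval I Z (conjRev b) = D at *
  generalize seqEval (-I) W (conjRev a) = C' at *
  generalize seqEval (-I) W (conjRev b) = D' at *
  generalize seqEval I z p = P at *
  generalize seqEval I z q = Q at *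
  generalize seqEval (-I) w p = P' at *
  generalize seqEval (-I) w q = Q' at *
  -- Products of the reversed conjugates are the corresponding products of adjoints.
  have mul_eq : ∀ {e e' f f' : K}, Z * e = Zm * f → W * e' = Wm * f' → e * e' = f * f' := by
    intro e e' f f' h h'
    linear_combination (-e * e') * hZ + W * e' * h + Zm * f * h' + f * f' * hZm
  have cc := mul_eq ra ra'
  have cd := mul_eq ra rb'
  have dc := mul_eq rb ra'
  have dd := mul_eq rb rb'
  push_cast
  linear_combination P * P' * dd - y * P * Q' * dc - x * Q * P' * cd + x * y * Q * Q' * cc +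
    (P * P' + x * y * Q * Q') * n1 + 2 * (m : K) * Q * Q' * hzn + 2 * (m : K) * n2

/-! ### Sums of Golay lengths -/

/-- `force n f` is `f n`, evaluated only after `n` has been reduced to a numeral. -/
def force {α : Type*} (n : ℕ) (f : ℕ → α) : α :=
  match n with
  | 0 => f 0
  | k + 1 => f (k + 1)

theorem force_eq {α : Type*} (n : ℕ) (f : ℕ → α) : force n f = f n := by cases n <;> rfl

/-- The bitwise union of the masks `leaf c`, where `2 c` runs through the numbers
`y ∏ pᵢ ^ eᵢ < hi` other than `1`, with `pᵢ` in the list; the first argument bounds the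
depth of the recursion. -/
def maskUnion (leaf : ℕ → ℕ) (hi : ℕ) : ℕ → List ℕ → ℕ → ℕ
  | 0, _, _ => 0
  | n + 1, ps, y =>
    bif Nat.ble hi y then 0 else
      match ps with
      | [] => bif Nat.ble y 1 then 0 else leaf (y / 2)
      | p :: ps => maskUnion leaf hi n (p :: ps) (y * p) ||| maskUnion leaf hi n ps y

/-- The multipliers `2 c`, for `c` the length of a basic complex Golay pair. -/
def golayMultipliers : List ℕ := [26, 22, 10, 6, 2]

theorem isGolayNumber_half_of_mem {p : ℕ} (hp : p ∈ golayMultipliers) :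
    ∃ c, p = 2 * c ∧ IsGolayNumber c := by
  simp only [golayMultipliers, List.mem_cons, List.not_mem_nil, or_false] at hp
  rcases hp with rfl | rfl | rfl | rfl | rfl
  exacts [⟨13, rfl, isGolayNumber_thirteen⟩, ⟨11, rfl, isGolayNumber_eleven⟩,
    ⟨5, rfl, isGolayNumber_five⟩, ⟨3, rfl, isGolayNumber_three⟩, ⟨1, rfl, isGolayNumber_one⟩]

theorem exists_of_testBit_maskUnion {leaf : ℕ → ℕ} {hi i : ℕ} (n : ℕ) {ps : List ℕ} {y : ℕ}
    (hps : ∀ p ∈ ps, p ∈ golayMultipliers) (hy : y = 1 ∨ ∃ c, y = 2 * c ∧ IsGolayNumber c)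
    (h : (maskUnion leaf hi n ps y).testBit i = true) :
    ∃ c, IsGolayNumber c ∧ (leaf c).testBit i = true := by
  induction n generalizing ps y with
  | zero => simp [maskUnion] at h
  | succ n ih =>
    unfold maskUnion at h
    cases hb : Nat.ble hi y
    · rw [hb, cond_false] at h
      cases ps with
      | nil =>
        rcases hy with rfl | ⟨c, rfl, hc⟩
        · have h1 : Nat.ble 1 1 = true := rfl
          simp [h1] at h
        · cases hb' : Nat.ble (2 * c) 1
          · simp only [hb', cond_false, Nat.mul_div_cancel_left c two_pos] at h
            exact ⟨c, hc, h⟩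
          · simp [hb'] at h
      | cons p ps =>
        simp only [Nat.testBit_or, Bool.or_eq_true] at h
        rcases h with h | h
        · refine ih hps ?_ h
          obtain ⟨d, rfl, hd⟩ := isGolayNumber_half_of_mem (hps p (by simp))
          rcases hy with rfl | ⟨c, rfl, hc⟩
          · exact Or.inr ⟨d, by ring, hd⟩
          · exact Or.inr ⟨2 * c * d, by ring, hc.two_mul_mul hd⟩
        · exact ih (fun q hq => hps q (by simp [hq])) hy h
    · rw [hb, cond_true] at h
      simp at h

/-- `v` is a sum of at most `s` lengths of complex Golay pairs. -/
def IsGolaySum (s v : ℕ) : Prop :=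
  ∃ l : List ℕ, l.length ≤ s ∧ l.sum = v ∧ ∀ c ∈ l, IsGolayNumber c

theorem IsGolaySum.cons {s v c : ℕ} (h : IsGolaySum s v) (hc : IsGolayNumber c) :
    IsGolaySum (s + 1) (c + v) := by
  obtain ⟨l, hl, rfl, hl'⟩ := h
  exact ⟨c :: l, by simpa using hl, by simp, by simpa using ⟨hc, hl'⟩⟩

theorem IsGolaySum.mono {s t v : ℕ} (h : IsGolaySum s v) (hst : s ≤ t) : IsGolaySum t v := by
  obtain ⟨l, hl, hv, hl'⟩ := h
  exact ⟨l, hl.trans hst, hv, hl'⟩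

/-- If the bits of `m` mark numbers that are sums of `s` Golay numbers, then the bits of
`addGolay m` mark numbers that are sums of `s + 1` of them. -/
def addGolay (m : ℕ) : ℕ :=
  m ||| maskUnion (fun c => m <<< c) (2 ^ 14) 20 golayMultipliers 1

theorem isGolaySum_of_testBit_addGolay {m s : ℕ} (hm : ∀ i, m.testBit i = true → IsGolaySum s i)
    (i : ℕ) (h : (addGolay m).testBit i = true) : IsGolaySum (s + 1) i := by
  rw [addGolay, Nat.testBit_or, Bool.or_eq_true] at h
  rcases h with h | h
  · exact (hm i h).mono (Nat.le_succ s)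
  · obtain ⟨c, hc, h⟩ := exists_of_testBit_maskUnion 20 (fun p hp => hp) (Or.inl rfl) h
    rw [Nat.testBit_shiftLeft, Bool.and_eq_true, decide_eq_true_eq] at h
    have := (hm _ h.2).cons hc
    rwa [Nat.add_sub_cancel' h.1] at this

theorem testBit_of_mod_eq {m k i : ℕ} (h : m % 2 ^ k = 2 ^ k - 1) (hi : i < k) :
    m.testBit i = true := by
  have := Nat.testBit_mod_two_pow m k i
  rw [h, Nat.testBit_two_pow_sub_one] at this
  simpa [hi] using this.symm

theorem isGolaySum_three {v : ℕ} (hv : v < 2 ^ 13) : IsGolaySum 3 v := by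
  have h0 : ∀ i, Nat.testBit 1 i = true → IsGolaySum 0 i := fun i hi => by
    rw [Nat.testBit_one_eq_true_iff_self_eq_zero] at hi
    exact ⟨[], by simp [hi]⟩
  have h : (force (addGolay 1) fun m => force (addGolay m) addGolay) % 2 ^ 2 ^ 13 =
      2 ^ 2 ^ 13 - 1 := by
    decide +kernel
  rw [force_eq, force_eq] at h
  exact isGolaySum_of_testBit_addGolay (isGolaySum_of_testBit_addGolay
    (isGolaySum_of_testBit_addGolay h0)) v (testBit_of_mod_eq h hv)

/-- The bits of `smear m` are those at distance less than `16` above a bit of `m`. -/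
def smear (m : ℕ) : ℕ :=
  force (m ||| m <<< 1) fun m => force (m ||| m <<< 2) fun m => force (m ||| m <<< 4) fun m =>
    m ||| m <<< 8

theorem testBit_or_shiftLeft {m k i : ℕ} (h : (m ||| m <<< k).testBit i = true) :
    ∃ j, j ≤ i ∧ i ≤ j + k ∧ m.testBit j = true := by
  rw [Nat.testBit_or, Nat.testBit_shiftLeft, Bool.or_eq_true, Bool.and_eq_true,
    decide_eq_true_eq] at h
  rcases h with h | ⟨h, h'⟩
  · exact ⟨i, le_rfl, Nat.le_add_right i k, h⟩
  · exact ⟨i - k, Nat.sub_le i k, by omega, h'⟩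

theorem exists_of_testBit_smear {m i : ℕ} (h : (smear m).testBit i = true) :
    ∃ j, j ≤ i ∧ i ≤ j + 15 ∧ m.testBit j = true := by
  simp only [smear, force_eq] at h
  obtain ⟨j, h1, h2, h⟩ := testBit_or_shiftLeft h
  obtain ⟨k, h3, h4, h⟩ := testBit_or_shiftLeft h
  obtain ⟨l, h5, h6, h⟩ := testBit_or_shiftLeft h
  obtain ⟨o, h7, h8, h⟩ := testBit_or_shiftLeft h
  exact ⟨o, by omega, by omega, h⟩

/-- The Golay numbers below `2 ^ b'`, rounded up to multiples of `⌊2 ^ b / 17⌋`, leave no gap of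
`16` consecutive multiples between `2 ^ b` and `2 ^ b'`. -/
def golayGapCheck (b b' : ℕ) : Bool :=
  force (2 ^ b / 17) fun r =>
    force (maskUnion (fun c => 1 <<< ((c + r - 1) / r)) (2 ^ (b' + 1)) 64 golayMultipliers 1)
      fun m => (smear m >>> (2 ^ b / r)) % 2 ^ (2 ^ b' / r + 1 - 2 ^ b / r) ==
        2 ^ (2 ^ b' / r + 1 - 2 ^ b / r) - 1

/-- Every `v` with `2 ^ b ≤ v < 2 ^ b'` exceeds some Golay number by less than `2 ^ b`. -/
def GolayGap (b b' : ℕ) : Prop :=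
  ∀ v, 2 ^ b ≤ v → v < 2 ^ b' → ∃ c, IsGolayNumber c ∧ c ≤ v ∧ v < c + 2 ^ b

theorem golayGap_of_golayGapCheck {b b' : ℕ} (hb : 17 ≤ 2 ^ b)
    (h : golayGapCheck b b' = true) : GolayGap b b' := by
  intro v hv hv'
  simp only [golayGapCheck, force_eq, beq_iff_eq] at h
  -- A Golay number whose rounded value is at most 15 steps of size `r` below `v` differs from `v`
  -- by less than 17 steps: one more step is lost in rounding `v` down and one in rounding `c` up.
  obtain ⟨r, hr⟩ : ∃ r, r = 2 ^ b / 17 := ⟨_, rfl⟩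
  rw [← hr] at h
  have hr0 : 0 < r := by rw [hr]; exact Nat.div_pos hb (by norm_num)
  have hr17 : r * 17 ≤ 2 ^ b := by rw [hr]; exact Nat.div_mul_le_self _ _
  have hq : 2 ^ b / r ≤ v / r := Nat.div_le_div_right hv
  have hq' : v / r ≤ 2 ^ b' / r := Nat.div_le_div_right hv'.le
  have hbit := testBit_of_mod_eq h (i := v / r - 2 ^ b / r) (by omega)
  rw [Nat.testBit_shiftRight, Nat.add_sub_cancel' hq] at hbit
  obtain ⟨j, hj, hj', hbit⟩ := exists_of_testBit_smear hbit
  obtain ⟨c, hc, hbit⟩ := exists_of_testBit_maskUnion 64 (fun p hp => hp) (Or.inl rfl) hbit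
  rw [Nat.one_shiftLeft, Nat.testBit_two_pow] at hbit
  simp only [decide_eq_true_eq] at hbit
  have h1 : c ≤ j * r := by
    have := Nat.lt_div_mul_add (a := c + r - 1) hr0
    rw [hbit] at this
    omega
  have h2 : j * r ≤ c + r - 1 := by rw [← hbit]; exact Nat.div_mul_le_self _ _
  have h3 : v / r * r ≤ v := Nat.div_mul_le_self _ _
  have h4 := Nat.lt_div_mul_add (a := v) hr0
  have h5 : j * r ≤ v / r * r := Nat.mul_le_mul_right r hj
  have h6 : v / r * r ≤ (j + 15) * r := Nat.mul_le_mul_right r hj'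
  have h7 : (j + 15) * r = j * r + 15 * r := by ring
  exact ⟨c, hc, by omega, by omega⟩

theorem golayGap_thirteen : GolayGap 13 19 :=
  golayGap_of_golayGapCheck (by norm_num) (by decide +kernel)

theorem golayGap_nineteen : GolayGap 19 26 :=
  golayGap_of_golayGapCheck (by norm_num) (by decide +kernel)

theorem golayGap_twentySix : GolayGap 26 34 :=
  golayGap_of_golayGapCheck (by norm_num) (by decide +kernel)

theorem golayGap_thirtyFour : GolayGap 34 43 :=
  golayGap_of_golayGapCheck (by norm_num) (by decide +kernel)

theorem IsGolayNumber.mul_two_pow {c : ℕ} (hc : IsGolayNumber c) (k : ℕ) :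
    IsGolayNumber (c * 2 ^ k) := by
  induction k with
  | zero => simpa using hc
  | succ k ih =>
    have := isGolayNumber_one.two_mul_mul ih
    rwa [show 2 * 1 * (c * 2 ^ k) = c * 2 ^ (k + 1) by ring] at this

/-- Since Golay numbers may be doubled, a bound on the relative size of gaps persists. -/
theorem GolayGap.add {b b' : ℕ} (h : GolayGap b b') (k : ℕ) : GolayGap (b + k) (b' + k) := by
  intro v hv hv'
  have hk : 0 < 2 ^ k := by positivity
  rw [pow_add] at hv hv'
  obtain ⟨c, hc, h1, h2⟩ := h (v / 2 ^ k) ((Nat.le_div_iff_mul_le hk).2 hv)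
    (Nat.div_lt_of_lt_mul (by rwa [mul_comm]))
  refine ⟨c * 2 ^ k, hc.mul_two_pow k, (Nat.mul_le_mul_right _ h1).trans (Nat.div_mul_le_self _ _),
    ?_⟩
  have h3 := Nat.lt_div_mul_add (a := v) hk
  have h4 : (v / 2 ^ k + 1) * 2 ^ k ≤ (c + 2 ^ b) * 2 ^ k := Nat.mul_le_mul_right _ h2
  rw [add_mul, add_mul, ← pow_add] at h4
  omega

theorem GolayGap.isGolaySum_succ {b b' s : ℕ} (h : GolayGap b b')
    (hs : ∀ v < 2 ^ b, IsGolaySum s v) : ∀ v < 2 ^ b', IsGolaySum (s + 1) v := by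
  intro v hv
  rcases lt_or_ge v (2 ^ b) with hb | hb
  · exact (hs v hb).mono (Nat.le_succ s)
  · obtain ⟨c, hc, h1, h2⟩ := h v hb hv
    have := (hs (v - c) (by omega)).cons hc
    rwa [Nat.add_sub_cancel' h1] at this

theorem isGolaySum_four : ∀ v < 2 ^ 19, IsGolaySum 4 v :=
  golayGap_thirteen.isGolaySum_succ fun _ => isGolaySum_three

theorem isGolaySum_five : ∀ v < 2 ^ 26, IsGolaySum 5 v :=
  golayGap_nineteen.isGolaySum_succ isGolaySum_four

theorem isGolaySum_add_six (i : ℕ) : ∀ v < 2 ^ (34 + 9 * i), IsGolaySum (6 + i) v := by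
  induction i with
  | zero => exact golayGap_twentySix.isGolaySum_succ isGolaySum_five
  | succ i ih =>
    have h := (golayGap_thirtyFour.add (9 * i)).isGolaySum_succ ih
    rwa [show 43 + 9 * i = 34 + 9 * (i + 1) by ring] at h

/-- Every `v` is a sum of `s` lengths of complex Golay pairs, where `s ≤ 3` or
`2 s + 1 ≤ (3 / 13) log₂ (2 v) + 8`. -/
theorem exists_isGolaySum (v : ℕ) :
    ∃ s, IsGolaySum s v ∧ (s ≤ 3 ∨ 2 ^ (13 * (2 * s - 7)) ≤ (2 * v) ^ 3) := by
  have key : ∀ {a s : ℕ}, 2 ^ a ≤ v → 13 * (2 * s - 7) ≤ (a + 1) * 3 →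
      2 ^ (13 * (2 * s - 7)) ≤ (2 * v) ^ 3 := fun {a s} ha h =>
    calc 2 ^ (13 * (2 * s - 7)) ≤ 2 ^ ((a + 1) * 3) := Nat.pow_le_pow_right two_pos h
      _ = (2 * 2 ^ a) ^ 3 := by rw [pow_mul]; ring
      _ ≤ (2 * v) ^ 3 := by gcongr
  rcases lt_or_ge v (2 ^ 13) with h | h3
  · exact ⟨3, isGolaySum_three h, Or.inl le_rfl⟩
  rcases lt_or_ge v (2 ^ 19) with h | h4
  · exact ⟨4, isGolaySum_four v h, Or.inr (key h3 (by norm_num))⟩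
  rcases lt_or_ge v (2 ^ 26) with h | h5
  · exact ⟨5, isGolaySum_five v h, Or.inr (key h4 (by norm_num))⟩
  have large : ∀ i, v < 2 ^ (34 + 9 * i) →
      ∃ s, IsGolaySum s v ∧ (s ≤ 3 ∨ 2 ^ (13 * (2 * s - 7)) ≤ (2 * v) ^ 3) := by
    intro i
    induction i with
    | zero => exact fun h => ⟨6, isGolaySum_add_six 0 v h, Or.inr (key h5 (by norm_num))⟩
    | succ i ih =>
      intro h
      rcases lt_or_ge v (2 ^ (34 + 9 * i)) with h' | h'
      · exact ih h'
      · exact ⟨6 + (i + 1), isGolaySum_add_six (i + 1) v h, Or.inr (key h' (by omega))⟩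
  exact large v (Nat.lt_two_pow_self.trans_le (Nat.pow_le_pow_right two_pos (by omega)))

/-- `F` is a complementary family of quaternary sequences of total length `v`: the aperiodic
autocorrelations of its members add up to zero. -/
structure IsComplementary (F : List (List ℕ)) (v : ℕ) : Prop where
  sum_length : (F.map List.length).sum = v
  sum_norm : ∀ {K : Type} [CommRing K] (I z w : K), I ^ 2 = -1 → z * w = 1 →
    (F.map fun a => seqEval I z a * seqEval (-I) w a).sum = (v : K)

theorem isComplementary_nil : IsComplementary [] 0 := ⟨rfl, fun _ _ _ _ _ => by simp⟩

theorem isComplementary_singleton : IsComplementary [[0]] 1 :=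
  ⟨rfl, fun _ _ _ _ _ => by simp [seqEval]⟩

theorem IsComplementary.append {F G : List (List ℕ)} {v w : ℕ} (hF : IsComplementary F v)
    (hG : IsComplementary G w) : IsComplementary (F ++ G) (v + w) :=
  ⟨by simp [hF.sum_length, hG.sum_length], fun I z w hI hz => by
    simp [hF.sum_norm I z w hI hz, hG.sum_norm I z w hI hz]⟩

theorem IsGolayPair.isComplementary {n : ℕ} {a b : List ℕ} (h : IsGolayPair n a b) :
    IsComplementary [a, b] (2 * n) :=
  ⟨by simp [h.length_left, h.length_right, two_mul], fun I z w hI hz => by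
    simpa using h.norm_add_norm I z w hI hz⟩

theorem IsGolaySum.exists_isComplementary {s v : ℕ} (h : IsGolaySum s v) :
    ∃ F, F.length ≤ 2 * s ∧ IsComplementary F (2 * v) := by
  obtain ⟨l, hl, rfl, hc⟩ := h
  suffices ∃ F, F.length ≤ 2 * l.length ∧ IsComplementary F (2 * l.sum) by
    obtain ⟨F, h1, h2⟩ := this
    exact ⟨F, by omega, h2⟩
  clear hl
  induction l with
  | nil => exact ⟨[], by simp, isComplementary_nil⟩
  | cons c l ih =>
    obtain ⟨F, h1, h2⟩ := ih fun c hc' => hc c (by simp [hc'])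
    obtain ⟨a, b, hab⟩ := hc c (by simp)
    refine ⟨[a, b] ++ F, by simp; omega, ?_⟩
    rw [List.sum_cons, mul_add]
    exact hab.isComplementary.append h2

theorem exists_isComplementary (v : ℕ) :
    ∃ F, IsComplementary F v ∧ (F.length : ℝ) ≤ 3 / 13 * Real.logb 2 v + 8 := by
  obtain ⟨s, hs, hbound⟩ := exists_isGolaySum (v / 2)
  obtain ⟨F, hF, hF'⟩ := hs.exists_isComplementary
  have hlog : ((2 * s + 1 : ℕ) : ℝ) ≤ 3 / 13 * Real.logb 2 v + 8 := by
    have h0 : 0 ≤ Real.logb 2 v := by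
      rcases Nat.eq_zero_or_pos v with rfl | hv
      · simp
      · exact Real.logb_nonneg one_lt_two (by exact_mod_cast hv)
    rcases Nat.lt_or_ge 3 s with h3 | h3
    · have h := hbound.resolve_left (by omega)
      have h1 : 2 ^ (13 * (2 * s - 7)) ≤ v ^ 3 :=
        h.trans (Nat.pow_le_pow_left (Nat.mul_div_le v 2) 3)
      have h2 : Real.logb 2 ((2 : ℝ) ^ (13 * (2 * s - 7))) ≤ Real.logb 2 ((v : ℝ) ^ 3) :=
        Real.logb_le_logb_of_le one_lt_two (by positivity) (by exact_mod_cast h1)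
      rw [Real.logb_pow, Real.logb_pow, Real.logb_self_eq_one one_lt_two] at h2
      push_cast [show 7 ≤ 2 * s by omega] at h2 ⊢
      linarith
    · have : ((2 * s + 1 : ℕ) : ℝ) ≤ 7 := by exact_mod_cast (by omega : 2 * s + 1 ≤ 7)
      linarith
  rcases Nat.even_or_odd' v with ⟨w, hw | hw⟩
  · have hv : 2 * (v / 2) = v := by omega
    rw [hv] at hF'
    exact ⟨F, hF', le_trans (by exact_mod_cast (by omega : F.length ≤ 2 * s + 1)) hlog⟩
  · have hv : 1 + 2 * (v / 2) = v := by omega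
    have h := isComplementary_singleton.append hF'
    rw [hv] at h
    exact ⟨_, h, le_trans (by exact_mod_cast (by simp; omega)) hlog⟩

/-! ### The Pauli group and its real monomial representation -/

/-- The doubling embedding of `ZMod 2` into `ZMod 4`. -/
def zmodDouble : ZMod 2 →+ ZMod 4 where
  toFun a := 2 * (a.val : ZMod 4)
  map_zero' := rfl
  map_add' := by decide

/-- The Pauli group on `m` qubits: the products `i ^ phase X ^ flip Z ^ sign`, where `X` and `Z` are
the bit flips and the sign changes of `m` qubits. -/
@[ext]
structure PauliGroup (m : ℕ) where
  /-- The exponent of the scalar `i`. -/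
  phase : ZMod 4
  /-- The qubits that are flipped. -/
  flip : Fin m → ZMod 2
  /-- The qubits whose sign is changed. -/
  sign : Fin m → ZMod 2

namespace PauliGroup

open SignedGroup

variable {m : ℕ}

instance : Mul (PauliGroup m) :=
  ⟨fun g h => ⟨g.phase + h.phase + zmodDouble (g.sign ⬝ᵥ h.flip), g.flip + h.flip,
    g.sign + h.sign⟩⟩

instance : One (PauliGroup m) := ⟨⟨0, 0, 0⟩⟩

instance : Inv (PauliGroup m) :=
  ⟨fun g => ⟨-g.phase + zmodDouble (g.sign ⬝ᵥ g.flip), g.flip, g.sign⟩⟩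

theorem mul_def (g h : PauliGroup m) : g * h =
    ⟨g.phase + h.phase + zmodDouble (g.sign ⬝ᵥ h.flip), g.flip + h.flip, g.sign + h.sign⟩ := rfl

theorem one_def : (1 : PauliGroup m) = ⟨0, 0, 0⟩ := rfl

theorem inv_def (g : PauliGroup m) :
    g⁻¹ = ⟨-g.phase + zmodDouble (g.sign ⬝ᵥ g.flip), g.flip, g.sign⟩ := rfl

theorem add_self_eq_zero_of_zmod_two (x : Fin m → ZMod 2) : x + x = 0 := by
  ext i
  exact CharTwo.add_self_eq_zero (x i)

instance : Group (PauliGroup m) :=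
  Group.ofLeftAxioms
    (fun g h k => by
      simp only [mul_def, add_dotProduct, dotProduct_add, map_add, PauliGroup.mk.injEq]
      exact ⟨by ring, add_assoc _ _ _, add_assoc _ _ _⟩)
    (fun g => by simp [mul_def, one_def])
    (fun g => by
      have h : ∀ a : ZMod 2, zmodDouble a + zmodDouble a = 0 := by decide
      simp only [mul_def, inv_def, one_def, add_self_eq_zero_of_zmod_two, PauliGroup.mk.injEq,
        and_true]
      linear_combination h (g.sign ⬝ᵥ g.flip))

/-- A power of the scalar `i`. -/
def scalar (q : ZMod 4) : PauliGroup m := ⟨q, 0, 0⟩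

theorem scalar_mul (q : ZMod 4) (g : PauliGroup m) :
    scalar q * g = ⟨q + g.phase, g.flip, g.sign⟩ := by
  simp [scalar, mul_def]

theorem mul_scalar (q : ZMod 4) (g : PauliGroup m) : g * scalar q = scalar q * g := by
  simp [scalar, mul_def, add_comm]

theorem scalar_mul_scalar (q r : ZMod 4) :
    (scalar q * scalar r : PauliGroup m) = scalar (q + r) := by
  rw [scalar_mul]
  rfl

theorem scalar_zero : (scalar 0 : PauliGroup m) = 1 := rfl

instance : SignedGroup (PauliGroup m) where
  negOne := scalar 2
  negOne_central := Subgroup.mem_center_iff.2 fun g => mul_scalar 2 g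
  negOne_order := orderOf_eq_prime (by rw [sq, scalar_mul_scalar]; rfl) fun h => by
    have := congrArg phase h
    exact absurd this (by decide : (2 : ZMod 4) ≠ 0)

theorem negOne_eq : (negOne : PauliGroup m) = scalar 2 := rfl

/-- The Jordan-Wigner generators of square `1`. -/
def genE (j : ℕ) : PauliGroup m :=
  ⟨0, fun i => if (i : ℕ) = j then 1 else 0, fun i => if (i : ℕ) < j then 1 else 0⟩

/-- The Jordan-Wigner generators of square `-1`. -/
def genF (j : ℕ) : PauliGroup m :=
  ⟨0, fun i => if (i : ℕ) = j then 1 else 0, fun i => if (i : ℕ) ≤ j then 1 else 0⟩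

theorem dotProduct_ite_eq (f : Fin m → ZMod 2) {j : ℕ} (hj : j < m) :
    (f ⬝ᵥ fun i => if (i : ℕ) = j then 1 else 0) = f ⟨j, hj⟩ := by
  have : (fun i : Fin m => if (i : ℕ) = j then (1 : ZMod 2) else 0) = Pi.single ⟨j, hj⟩ 1 := by
    ext i
    simp [Pi.single_apply, Fin.ext_iff]
  rw [this, dotProduct_single, mul_one]

theorem zmodDouble_ite (p : Prop) [Decidable p] :
    zmodDouble (if p then 1 else 0) = if p then 2 else 0 := by
  split_ifs <;> rfl

theorem genE_mul_genE_self {j : ℕ} (hj : j < m) : (genE j * genE j : PauliGroup m) = 1 := by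
  simp [genE, mul_def, one_def, dotProduct_ite_eq, hj, add_self_eq_zero_of_zmod_two]

theorem genF_mul_genF_self {j : ℕ} (hj : j < m) :
    (genF j * genF j : PauliGroup m) = negOne := by
  simp only [genF, mul_def, dotProduct_ite_eq _ hj, add_self_eq_zero_of_zmod_two, zmodDouble_ite,
    negOne_eq, scalar]
  simp

theorem genE_mul_genE {j k : ℕ} (hj : j < m) (hk : k < m) (h : j ≠ k) :
    (genE j * genE k : PauliGroup m) = negOne * (genE k * genE j) := by
  rw [negOne_eq, scalar_mul]
  simp only [genE, mul_def, dotProduct_ite_eq _ hj, dotProduct_ite_eq _ hk, zmodDouble_ite,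
    PauliGroup.mk.injEq]
  refine ⟨?_, add_comm _ _, add_comm _ _⟩
  rcases lt_or_gt_of_ne h with h' | h' <;> simp [h', h'.not_gt]; decide

theorem genF_mul_genF {j k : ℕ} (hj : j < m) (hk : k < m) (h : j ≠ k) :
    (genF j * genF k : PauliGroup m) = negOne * (genF k * genF j) := by
  rw [negOne_eq, scalar_mul]
  simp only [genF, mul_def, dotProduct_ite_eq _ hj, dotProduct_ite_eq _ hk, zmodDouble_ite,
    PauliGroup.mk.injEq]
  refine ⟨?_, add_comm _ _, add_comm _ _⟩
  rcases lt_or_gt_of_ne h with h' | h' <;> simp [h'.le, h'.not_ge]; decide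

theorem genE_mul_genF {j k : ℕ} (hj : j < m) (hk : k < m) :
    (genE j * genF k : PauliGroup m) = negOne * (genF k * genE j) := by
  rw [negOne_eq, scalar_mul]
  simp only [genE, genF, mul_def, dotProduct_ite_eq _ hj, dotProduct_ite_eq _ hk, zmodDouble_ite,
    PauliGroup.mk.injEq]
  refine ⟨?_, add_comm _ _, add_comm _ _⟩
  rcases lt_or_ge k j with h' | h'
  · simp [h', h'.not_ge]
  · simp [h', Nat.not_lt.2 h']
    decide

/-- The real part of a power of `i`. -/
def reI : ZMod 4 → ℤ
  | 0 => 1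
  | 1 => 0
  | 2 => -1
  | 3 => 0

/-- The inclusion of the exponents `{0, 1}` of the real basis `1, i` of the complex numbers. -/
def expI (b : Fin 2) : ZMod 4 := (b : ℕ)

/-- The real matrices of the Pauli group: on the complex functions of `m` bits,
`i ^ phase X ^ flip Z ^ sign` maps the basis vector at `y` to `i ^ phase (-1) ^ (sign ⬝ y)` times
the basis vector at `y + flip`, and complex scalars are replaced by their matrices in the real
basis `1, i`. -/
def repMatrix (g : PauliGroup m) :
    Matrix ((Fin m → ZMod 2) × Fin 2) ((Fin m → ZMod 2) × Fin 2) ℝ := fun a b =>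
  if a.1 = b.1 + g.flip then
    (reI (g.phase + zmodDouble (g.sign ⬝ᵥ b.1) + expI b.2 - expI a.2) : ℝ) else 0

theorem repMatrix_one : repMatrix (1 : PauliGroup m) = 1 := by
  have h : ∀ b c : Fin 2, reI (expI c - expI b) = if b = c then 1 else 0 := by decide
  ext ⟨y, b⟩ ⟨y', c⟩
  by_cases hy : y = y'
  · subst hy
    simp only [repMatrix, one_def, add_zero, zero_dotProduct, map_zero, zero_add, if_true, h,
      Matrix.one_apply, Prod.mk.injEq, true_and]
    split_ifs <;> simp
  · simp [repMatrix, one_def, hy]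

theorem repMatrix_mul (g h : PauliGroup m) : repMatrix (g * h) = repMatrix g * repMatrix h := by
  have key : ∀ (s t : ZMod 4) (b c : Fin 2), reI (s + t + expI c - expI b) =
      ∑ d, reI (s + expI d - expI b) * reI (t + expI c - expI d) := by decide
  ext ⟨y, b⟩ ⟨y', c⟩
  rw [Matrix.mul_apply, Fintype.sum_prod_type, Finset.sum_eq_single (y' + h.flip)]
  · by_cases hy : y = y' + h.flip + g.flip
    · have hy' : y = y' + (g.flip + h.flip) := by rw [hy]; abel
      simp only [repMatrix, mul_def, if_pos hy, if_pos hy', if_true]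
      have := key (g.phase + zmodDouble (g.sign ⬝ᵥ (y' + h.flip)))
        (h.phase + zmodDouble (h.sign ⬝ᵥ y')) b c
      simp only [← Int.cast_mul, ← Int.cast_sum]
      rw [← this]
      congr 2
      simp only [add_dotProduct, dotProduct_add, map_add]
      ring
    · have hy' : ¬ y = y' + (g.flip + h.flip) := fun e => hy (by rw [e]; abel)
      simp [repMatrix, mul_def, hy, hy']
  · intro x _ hx
    simp [repMatrix, hx]
  · simp

theorem repMatrix_negOne : repMatrix (negOne : PauliGroup m) = -1 := by
  have h : ∀ b c : Fin 2, reI (2 + expI c - expI b) = if b = c then -1 else 0 := by decide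
  ext ⟨y, b⟩ ⟨y', c⟩
  by_cases hy : y = y'
  · subst hy
    simp only [repMatrix, negOne_eq, scalar, add_zero, zero_dotProduct, map_zero, if_true, h,
      Matrix.neg_apply, Matrix.one_apply, Prod.mk.injEq, true_and]
    split_ifs <;> simp
  · simp [repMatrix, negOne_eq, scalar, hy]

theorem repMatrix_eq (g : PauliGroup m) (a b : (Fin m → ZMod 2) × Fin 2) :
    repMatrix g a b = 0 ∨ repMatrix g a b = 1 ∨ repMatrix g a b = -1 := by
  have h : ∀ s : ZMod 4, reI s = 0 ∨ reI s = 1 ∨ reI s = -1 := by decide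
  unfold repMatrix
  split_ifs
  · rcases h (g.phase + zmodDouble (g.sign ⬝ᵥ b.1) + expI b.2 - expI a.2) with h | h | h <;>
      simp [h]
  · exact Or.inl rfl

theorem repMatrix_ne_zero_iff (g : PauliGroup m) (a b : (Fin m → ZMod 2) × Fin 2) :
    repMatrix g a b ≠ 0 ↔ a.1 = b.1 + g.flip ∧
      reI (g.phase + zmodDouble (g.sign ⬝ᵥ b.1) + expI b.2 - expI a.2) ≠ 0 := by
  unfold repMatrix
  split_ifs with h <;> simp [h]

theorem existsUnique_repMatrix_row (g : PauliGroup m) (a : (Fin m → ZMod 2) × Fin 2) :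
    ∃! b, repMatrix g a b ≠ 0 := by
  have h : ∀ (s : ZMod 4) (c : Fin 2), ∃ b : Fin 2, reI (s + expI b - expI c) ≠ 0 ∧
      ∀ d, reI (s + expI d - expI c) ≠ 0 → d = b := by decide
  obtain ⟨b, hb, hb'⟩ := h (g.phase + zmodDouble (g.sign ⬝ᵥ (a.1 - g.flip))) a.2
  refine ⟨(a.1 - g.flip, b), (repMatrix_ne_zero_iff g _ _).2 ⟨by simp, hb⟩, ?_⟩
  rintro ⟨y, d⟩ hd
  obtain ⟨h1, h2⟩ := (repMatrix_ne_zero_iff g _ _).1 hd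
  have hy : y = a.1 - g.flip := eq_sub_of_add_eq h1.symm
  subst hy
  exact Prod.ext rfl (hb' d h2)

theorem existsUnique_repMatrix_col (g : PauliGroup m) (b : (Fin m → ZMod 2) × Fin 2) :
    ∃! a, repMatrix g a b ≠ 0 := by
  have h : ∀ s : ZMod 4, ∃ c : Fin 2, reI (s - expI c) ≠ 0 ∧
      ∀ d, reI (s - expI d) ≠ 0 → d = c := by decide
  obtain ⟨c, hc, hc'⟩ := h (g.phase + zmodDouble (g.sign ⬝ᵥ b.1) + expI b.2)
  refine ⟨(b.1 + g.flip, c), (repMatrix_ne_zero_iff g _ _).2 ⟨rfl, hc⟩, ?_⟩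
  rintro ⟨y, d⟩ hd
  obtain ⟨h1, h2⟩ := (repMatrix_ne_zero_iff g _ _).1 hd
  exact Prod.ext h1 (hc' d h2)

theorem nonempty_remrep (m : ℕ) : Nonempty (Remrep (PauliGroup m) (2 ^ (m + 1))) := by
  let e : (Fin m → ZMod 2) × Fin 2 ≃ Fin (2 ^ (m + 1)) :=
    Fintype.equivFinOfCardEq (by simp [ZMod.card, pow_succ])
  refine ⟨⟨⟨⟨fun g => Matrix.reindexAlgEquiv ℝ ℝ e (repMatrix g), ?_⟩, ?_⟩, ?_, ?_⟩⟩
  · rw [repMatrix_one, map_one]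
  · intro g h
    simp only [repMatrix_mul, map_mul]
  · intro g
    exact ⟨fun i j => repMatrix_eq g (e.symm i) (e.symm j),
      fun i => e.existsUnique_congr_left.1 (existsUnique_repMatrix_row g (e.symm i)),
      fun j => e.existsUnique_congr_left.1 (existsUnique_repMatrix_col g (e.symm j))⟩
  · change Matrix.reindexAlgEquiv ℝ ℝ e (repMatrix negOne) = -1
    rw [repMatrix_negOne, map_neg, map_one]

end PauliGroup

/-! ### The square of a row built from complementary sequences -/

/-- The data of one orbit `{t, -t, 2u + t, 2u - t}` of positions in the design: the entries there
are `x_var` times the generators `E_gate` at `±t` and `F_gate` at `2u ± t`, up to powers of the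
imaginary unit, which is `I ^ exponent` at `t`. -/
structure Slot (k : ℕ) where
  /-- The index of the pair of anticommuting generators. -/
  gate : ℕ
  /-- The exponent of the imaginary unit. -/
  exponent : ℕ
  /-- The index of the variable. -/
  var : Fin k

/-- The slots of a list of sequences, each with its own variable, placed one after the other; each
sequence has its own pair of generators, the first one the pair of index `c`. -/
def slotList {k : ℕ} : ℕ → List (Fin k × List ℕ) → List (Slot k)
  | _, [] => []
  | c, d :: D => d.2.map (fun q => ⟨c, q, d.1⟩) ++ slotList (c + 1) D

theorem length_slotList {k : ℕ} (c : ℕ) (D : List (Fin k × List ℕ)) :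
    (slotList c D).length = (D.map fun d => d.2.length).sum := by
  induction D generalizing c with
  | nil => rfl
  | cons d D ih => simp [slotList, ih]

theorem gate_lt_of_mem_slotList {k : ℕ} {c : ℕ} {D : List (Fin k × List ℕ)} {s : Slot k}
    (hs : s ∈ slotList c D) : s.gate < c + D.length := by
  induction D generalizing c with
  | nil => simp [slotList] at hs
  | cons d D ih =>
    simp only [slotList, List.mem_append, List.mem_map] at hs
    rcases hs with ⟨q, -, rfl⟩ | hs
    · simp
    · have := ih hs
      rw [List.length_cons]
      omega

/-- Generators `E j` of square `1` and `F j` of square `-1`, for `j < m`, all of which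
anticommute. -/
structure IsCliffordSystem {A : Type*} [Ring A] (m : ℕ) (E F : ℕ → A) : Prop where
  E_sq : ∀ j < m, E j * E j = 1
  F_sq : ∀ j < m, F j * F j = -1
  E_E : ∀ i < m, ∀ j < m, i ≠ j → E i * E j = -(E j * E i)
  F_F : ∀ i < m, ∀ j < m, i ≠ j → F i * F j = -(F j * F i)
  E_F : ∀ i < m, ∀ j < m, E i * F j = -(F j * E i)

theorem add_mul_add_self_of_anticommute {A : Type*} [Ring A] {a b : A} (h : a * b = -(b * a)) :
    (a + b) * (a + b) = a * a + b * b := by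
  rw [add_mul, mul_add, mul_add, h]
  abel

section Clifford

variable {K A : Type*} [CommRing K] [Ring A] [Algebra K A] {k : ℕ}

theorem smul_mul_smul_anticommute {a b : A} (h : a * b = -(b * a)) (r s : K) :
    r • a * s • b = -(s • b * r • a) := by
  rw [smul_mul_smul_comm, smul_mul_smul_comm, h, smul_neg, mul_comm]

theorem smul_add_smul_anticommute {a b c : A} (ha : a * c = -(c * a)) (hb : b * c = -(c * b))
    (r s : K) : (r • a + s • b) * c = -(c * (r • a + s • b)) := by
  rw [add_mul, smul_mul_assoc, smul_mul_assoc, ha, hb, mul_add, mul_smul_comm, mul_smul_comm,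
    smul_neg, smul_neg, neg_add]

/-- The sum of the four entries of the slot `s` at the positions `t, -t, 2u + t, 2u - t`. Here `z`
is the cyclic shift, `w` its inverse, and `J` stands for the shift by `2u`. -/
def slotTerm (E F : ℕ → A) (I z w J : K) (x : Fin k → K) (t : ℕ) (s : Slot k) : A :=
  (x s.var * (z ^ t * I ^ s.exponent + w ^ t * (-I) ^ s.exponent)) • E s.gate +
    (x s.var * J * (z ^ t * I ^ s.exponent - w ^ t * (-I) ^ s.exponent)) • F s.gate

/-- The sum of the entries in consecutive slots starting at position `p`. -/
def slotSum (E F : ℕ → A) (I z w J : K) (x : Fin k → K) : ℕ → List (Slot k) → A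
  | _, [] => 0
  | p, s :: L => slotTerm E F I z w J x p s + slotSum E F I z w J x (p + 1) L

theorem slotSum_append (E F : ℕ → A) (I z w J : K) (x : Fin k → K) (p : ℕ)
    (L M : List (Slot k)) : slotSum E F I z w J x p (L ++ M) =
      slotSum E F I z w J x p L + slotSum E F I z w J x (p + L.length) M := by
  induction L generalizing p with
  | nil => simp [slotSum]
  | cons s L ih =>
    simp only [List.cons_append, slotSum, ih, List.length_cons, add_assoc, add_comm 1]

theorem slotSum_eq_sum_range (E F : ℕ → A) (I z w J : K) (x : Fin k → K) (p : ℕ)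
    (L : List (Slot k)) (s₀ : Slot k) : slotSum E F I z w J x p L =
      ∑ t ∈ Finset.range L.length, slotTerm E F I z w J x (p + t) (L.getD t s₀) := by
  induction L generalizing p with
  | nil => simp [slotSum]
  | cons s L ih =>
    rw [slotSum, ih, List.length_cons, Finset.sum_range_succ']
    simp only [List.getD_cons_succ, List.getD_cons_zero, add_zero,
      add_comm _ (slotTerm _ _ _ _ _ _ _ p s)]
    simp only [add_assoc, add_comm 1]

/-- Over one sequence with polynomial `α`, the entries add up to
`x ((α + α*) E + J (α - α*) F)`. -/
theorem slotSum_map (E F : ℕ → A) (I z w J : K) (x : Fin k → K) (p c : ℕ) (l : Fin k)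
    (a : List ℕ) : slotSum E F I z w J x p (a.map fun q => ⟨c, q, l⟩) =
      (x l * (z ^ p * seqEval I z a + w ^ p * seqEval (-I) w a)) • E c +
        (x l * J * (z ^ p * seqEval I z a - w ^ p * seqEval (-I) w a)) • F c := by
  induction a generalizing p with
  | nil => simp [slotSum, seqEval]
  | cons q a ih =>
    rw [List.map_cons, slotSum, ih, slotTerm, add_add_add_comm, ← add_smul, ← add_smul]
    simp only [seqEval]
    congr 2 <;> ring

variable {E F : ℕ → A} {I z w J : K} {m : ℕ}

theorem slotSum_anticommute (h : IsCliffordSystem m E F) (x : Fin k → K) (p : ℕ) {j : ℕ}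
    (hj : j < m) (L : List (Slot k)) (hL : ∀ s ∈ L, j < s.gate ∧ s.gate < m) :
    E j * slotSum E F I z w J x p L = -(slotSum E F I z w J x p L * E j) ∧
      F j * slotSum E F I z w J x p L = -(slotSum E F I z w J x p L * F j) := by
  induction L generalizing p with
  | nil => simp [slotSum]
  | cons s L ih =>
    obtain ⟨h1, h2⟩ := ih (p + 1) fun s hs => hL s (by simp [hs])
    obtain ⟨hs, hs'⟩ := hL s (by simp)
    have hFE : F j * E s.gate = -(E s.gate * F j) := by rw [h.E_F _ hs' _ hj, neg_neg]
    simp only [slotSum, slotTerm, mul_add, add_mul, h1, h2, mul_smul_comm, smul_mul_assoc,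
      h.E_E j hj _ hs' hs.ne, h.F_F j hj _ hs' hs.ne, h.E_F j hj _ hs', hFE, smul_neg]
    constructor <;> abel

theorem le_gate_of_mem_slotList {c : ℕ} {D : List (Fin k × List ℕ)} {s : Slot k}
    (hs : s ∈ slotList c D) : c ≤ s.gate := by
  induction D generalizing c with
  | nil => simp [slotList] at hs
  | cons d D ih =>
    simp only [slotList, List.mem_append, List.mem_map] at hs
    rcases hs with ⟨q, -, rfl⟩ | hs
    · exact le_rfl
    · exact (Nat.le_succ c).trans (ih hs)

/-- The terms of different sequences anticommute, and
`((α + α*) E + J (α - α*) F)² = (α + α*)² - (α - α*)² = 4 α α*`. -/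
theorem slotSum_slotList_sq (h : IsCliffordSystem m E F) (hzw : z * w = 1) (hJ : J * J = 1)
    (x : Fin k → K) (p c : ℕ) (D : List (Fin k × List ℕ)) (hD : c + D.length ≤ m) :
    slotSum E F I z w J x p (slotList c D) * slotSum E F I z w J x p (slotList c D) =
      algebraMap K A (4 * (D.map fun d =>
        x d.1 ^ 2 * (seqEval I z d.2 * seqEval (-I) w d.2)).sum) := by
  induction D generalizing p c with
  | nil => simp [slotList, slotSum]
  | cons d D ih =>
    rw [List.length_cons] at hD
    have hc : c < m := by omega
    obtain ⟨hE, hF⟩ := slotSum_anticommute (I := I) (z := z) (w := w) (J := J) h x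
      (p + d.2.length) hc (slotList (c + 1) D) fun s hs =>
        ⟨le_gate_of_mem_slotList hs, (gate_lt_of_mem_slotList hs).trans_le (by omega)⟩
    have ih := ih (p + d.2.length) (c + 1) (by omega)
    rw [slotList, slotSum_append, slotSum_map, List.length_map]
    rw [add_mul_add_self_of_anticommute, ih, add_mul_add_self_of_anticommute
      (smul_mul_smul_anticommute (h.E_F c hc c hc) _ _)]
    · rw [smul_mul_smul_comm, smul_mul_smul_comm, h.E_sq c hc, h.F_sq c hc, smul_neg,
        ← sub_eq_add_neg, ← sub_smul, ← Algebra.algebraMap_eq_smul_one, ← map_add]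
      congr 1
      have hp : z ^ p * w ^ p = 1 := by rw [← mul_pow, hzw, one_pow]
      rw [List.map_cons, List.sum_cons]
      generalize seqEval I z d.2 = a
      generalize seqEval (-I) w d.2 = b
      linear_combination (4 * x d.1 ^ 2 * a * b) * hp -
        x d.1 ^ 2 * (z ^ p * a - w ^ p * b) ^ 2 * hJ
    · exact smul_add_smul_anticommute hE hF _ _

/-- The positions `0, u, 2u, 3u`, which are exceptional under the symmetries `t ↦ -t` and
`t ↦ t + 2u`, carry `(1 - J) E + (z ^ u + z ^ (-u)) I F` with the generators of index `0`. -/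
theorem add_slotSum_sq (h : IsCliffordSystem m E F) (hI : I ^ 2 = -1) (hzw : z * w = 1) {u : ℕ}
    (hz : z ^ u * z ^ u = J) (hw : w ^ u * w ^ u = J)
    (x : Fin k → K) (x₀ : K) (D : List (Fin k × List ℕ)) (hD : 1 + D.length ≤ m) :
    (((x₀ * (1 - J)) • E 0 + (x₀ * (z ^ u + w ^ u) * I) • F 0 +
      slotSum E F I z w J x 1 (slotList 1 D)) *
    ((x₀ * (1 - J)) • E 0 + (x₀ * (z ^ u + w ^ u) * I) • F 0 +
      slotSum E F I z w J x 1 (slotList 1 D))) =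
      algebraMap K A (4 * (x₀ ^ 2 + (D.map fun d =>
        x d.1 ^ 2 * (seqEval I z d.2 * seqEval (-I) w d.2)).sum)) := by
  have hm : 0 < m := by omega
  have hu : z ^ u * w ^ u = 1 := by rw [← mul_pow, hzw, one_pow]
  have hJ : J * J = 1 := by
    nth_rw 1 [← hz]
    rw [← hw]
    linear_combination (z ^ u * w ^ u + 1) * hu
  obtain ⟨hE, hF⟩ := slotSum_anticommute (I := I) (z := z) (w := w) (J := J) h x 1 hm
    (slotList 1 D) fun s hs =>
      ⟨le_gate_of_mem_slotList hs, (gate_lt_of_mem_slotList hs).trans_le hD⟩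
  rw [add_mul_add_self_of_anticommute, slotSum_slotList_sq h hzw hJ x 1 1 D hD,
    add_mul_add_self_of_anticommute (smul_mul_smul_anticommute (h.E_F 0 hm 0 hm) _ _)]
  · rw [smul_mul_smul_comm, smul_mul_smul_comm, h.E_sq 0 hm, h.F_sq 0 hm, smul_neg,
      ← sub_eq_add_neg, ← sub_smul, ← Algebra.algebraMap_eq_smul_one, ← map_add]
    congr 1
    linear_combination x₀ ^ 2 * hJ - x₀ ^ 2 * (z ^ u + w ^ u) ^ 2 * hI + x₀ ^ 2 * hz +
      x₀ ^ 2 * hw + 2 * x₀ ^ 2 * hu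
  · exact smul_add_smul_anticommute hE hF _ _

end Clifford

/-! ### The signed group ring and its circulant group ring -/

namespace SignedGroup

section monom

variable {R S : Type*} [Ring R] [SignedGroup S]

theorem monom_mul_monom (r r' : R) (s s' : S) :
    monom r s * monom r' s' = monom (r * r') (s * s') := by
  rw [monom, monom, ← map_mul, MonoidAlgebra.single_mul_single, monom]

theorem monom_add (r r' : R) (s : S) : monom (r + r') s = monom r s + monom r' s := by
  rw [monom, MonoidAlgebra.single_add, map_add, monom, monom]

theorem monom_negOne_mul (r : R) (s : S) : monom r (negOne * s) = -monom r s := by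
  rw [monom, RingQuot.mkRingHom_rel (RingRel.neg r s), map_neg, monom]

theorem monom_one_one : (monom 1 1 : SignedGroupRing R S) = 1 := by
  rw [monom, ← MonoidAlgebra.one_def, map_one]

/-- An element of the signed group ring with a central coefficient and a central group element is
central. -/
theorem monom_commute {r : R} {s : S} (hr : ∀ r', Commute r r') (hs : ∀ s', Commute s s')
    (y : SignedGroupRing R S) : Commute (monom r s) y := by
  obtain ⟨y, rfl⟩ := RingQuot.mkRingHom_surjective (RingRel R S) y
  exact (MonoidAlgebra.single_commute hs hr y).map (RingQuot.mkRingHom (RingRel R S))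

end monom

end SignedGroup

open SignedGroup

section

variable (N k m : ℕ) [NeZero N]

/-- The signed group ring of the Pauli group over the polynomials. It is kept opaque to instance
search, which would otherwise unfold the quotient. -/
def PauliRing : Type := SignedGroupRing (MvPolynomial (Fin k) ℝ) (PauliGroup m)

noncomputable instance : Ring (PauliRing k m) :=
  inferInstanceAs (Ring (SignedGroupRing (MvPolynomial (Fin k) ℝ) (PauliGroup m)))

/-- The group ring over the cyclic group of order `N` with coefficients in the signed group ring of
the Pauli group. Its elements are the first rows of circulant matrices. -/
abbrev CircRing : Type := AddMonoidAlgebra (PauliRing k m) (Fin N)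

variable {N k m}

/-- The element `r g` of the signed group ring of the Pauli group. -/
noncomputable def pauliMonom (r : MvPolynomial (Fin k) ℝ) (g : PauliGroup m) : PauliRing k m :=
  monom r g

theorem pauliMonom_mul (r r' : MvPolynomial (Fin k) ℝ) (g g' : PauliGroup m) :
    pauliMonom r g * pauliMonom r' g' = pauliMonom (r * r') (g * g') :=
  monom_mul_monom r r' g g'

theorem pauliMonom_add (r r' : MvPolynomial (Fin k) ℝ) (g : PauliGroup m) :
    pauliMonom (r + r') g = pauliMonom r g + pauliMonom r' g :=
  monom_add r r' g

theorem pauliMonom_negOne_mul (r : MvPolynomial (Fin k) ℝ) (g : PauliGroup m) :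
    pauliMonom r (negOne * g) = -pauliMonom r g :=
  monom_negOne_mul r g

theorem pauliMonom_one : (pauliMonom 1 1 : PauliRing k m) = 1 := monom_one_one

theorem pauliMonom_scalar_commute (r : MvPolynomial (Fin k) ℝ) (q : ZMod 4) (y : PauliRing k m) :
    Commute (pauliMonom r (PauliGroup.scalar q)) y :=
  monom_commute (fun r' => Commute.all r r') (fun s => (PauliGroup.mul_scalar q s).symm) y

/-- The central element `r i ^ q` at the position `t`. -/
noncomputable def centralSingle (t : Fin N) (r : MvPolynomial (Fin k) ℝ) (q : ZMod 4) :
    Subring.center (CircRing N k m) :=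
  ⟨AddMonoidAlgebra.single t (pauliMonom r (PauliGroup.scalar q)), Subring.mem_center_iff.2 fun y =>
    (AddMonoidAlgebra.single_commute (fun t' => add_comm t t')
      (pauliMonom_scalar_commute r q) y).symm.eq⟩

theorem centralSingle_mul (t t' : Fin N) (r r' : MvPolynomial (Fin k) ℝ) (q q' : ZMod 4) :
    (centralSingle t r q * centralSingle t' r' q' : Subring.center (CircRing N k m)) =
      centralSingle (t + t') (r * r') (q + q') := by
  apply Subtype.ext
  simp only [centralSingle, Subring.coe_mul, AddMonoidAlgebra.single_mul_single, pauliMonom_mul,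
    PauliGroup.scalar_mul_scalar]

theorem centralSingle_one : (centralSingle 0 1 0 : Subring.center (CircRing N k m)) = 1 := by
  apply Subtype.ext
  simp only [centralSingle, PauliGroup.scalar_zero, pauliMonom_one]
  rfl

theorem centralSingle_pow (t : Fin N) (r : MvPolynomial (Fin k) ℝ) (q : ZMod 4) (n : ℕ) :
    (centralSingle t r q ^ n : Subring.center (CircRing N k m)) =
      centralSingle (n • t) (r ^ n) (n * q) := by
  induction n with
  | zero => simp [centralSingle_one]
  | succ n ih =>
    rw [pow_succ, ih, centralSingle_mul, succ_nsmul, pow_succ]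
    congr 1
    push_cast
    ring

theorem centralSingle_two_add (t : Fin N) (r : MvPolynomial (Fin k) ℝ) (q : ZMod 4) :
    (centralSingle t r (2 + q) : Subring.center (CircRing N k m)) = -centralSingle t r q := by
  apply Subtype.ext
  simp only [centralSingle, ← PauliGroup.scalar_mul_scalar, ← PauliGroup.negOne_eq,
    pauliMonom_negOne_mul]
  exact AddMonoidAlgebra.single_neg _ _

theorem centralSingle_add (t : Fin N) (r r' : MvPolynomial (Fin k) ℝ) (q : ZMod 4) :
    (centralSingle t (r + r') q : Subring.center (CircRing N k m)) =
      centralSingle t r q + centralSingle t r' q := by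
  apply Subtype.ext
  simp only [centralSingle, pauliMonom_add, AddMonoidAlgebra.single_add]
  rfl

/-- An element of the Pauli group at the position `0`. -/
noncomputable def atZero (g : PauliGroup m) : CircRing N k m :=
  AddMonoidAlgebra.single 0 (pauliMonom 1 g)

theorem centralSingle_smul (t : Fin N) (r : MvPolynomial (Fin k) ℝ) (q : ZMod 4)
    (g : PauliGroup m) :
    (centralSingle t r q : Subring.center (CircRing N k m)) • (atZero g : CircRing N k m) =
      AddMonoidAlgebra.single t (pauliMonom r (PauliGroup.scalar q * g)) := by
  rw [Subring.smul_def, smul_eq_mul]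
  simp only [centralSingle, atZero, AddMonoidAlgebra.single_mul_single, pauliMonom_mul, add_zero,
    mul_one]

theorem isCliffordSystem_atZero : IsCliffordSystem m
    (fun j => (atZero (PauliGroup.genE j) : CircRing N k m))
    fun j => atZero (PauliGroup.genF j) := by
  have hone : (atZero 1 : CircRing N k m) = 1 := by
    rw [atZero, pauliMonom_one]
    rfl
  have hmul : ∀ g h : PauliGroup m, (atZero g * atZero h : CircRing N k m) = atZero (g * h) := by
    intro g h
    simp [atZero, AddMonoidAlgebra.single_mul_single, pauliMonom_mul]
  have hneg : ∀ g : PauliGroup m, (atZero (negOne * g) : CircRing N k m) = -atZero g := by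
    intro g
    rw [atZero, pauliMonom_negOne_mul]
    exact AddMonoidAlgebra.single_neg _ _
  refine ⟨fun j hj => ?_, fun j hj => ?_, fun i hi j hj h => ?_, fun i hi j hj h => ?_,
    fun i hi j hj => ?_⟩
  · rw [hmul, PauliGroup.genE_mul_genE_self hj, hone]
  · rw [hmul, PauliGroup.genF_mul_genF_self hj, ← mul_one negOne, hneg, hone]
  · rw [hmul, hmul, PauliGroup.genE_mul_genE hi hj h, hneg]
  · rw [hmul, hmul, PauliGroup.genF_mul_genF hi hj h, hneg]
  · rw [hmul, hmul, PauliGroup.genE_mul_genF hi hj, hneg]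

end

/-! ### The first row of the design -/

theorem PauliGroup.inv_scalar_mul_genE {m j : ℕ} (hj : j < m) (q : ZMod 4) :
    (scalar q * genE j : PauliGroup m)⁻¹ = scalar (-q) * genE j := by
  rw [inv_eq_iff_mul_eq_one, ← mul_scalar, mul_assoc, ← mul_assoc (scalar q), scalar_mul_scalar,
    add_neg_cancel, scalar_zero, one_mul, genE_mul_genE_self hj]

theorem PauliGroup.inv_scalar_mul_genF {m j : ℕ} (hj : j < m) (q : ZMod 4) :
    (scalar q * genF j : PauliGroup m)⁻¹ = scalar (2 - q) * genF j := by
  rw [inv_eq_iff_mul_eq_one, ← mul_scalar, mul_assoc, ← mul_assoc (scalar q), scalar_mul_scalar,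
    ← mul_assoc, mul_scalar, mul_assoc, genF_mul_genF_self hj, negOne_eq, scalar_mul_scalar,
    show q + (2 - q) + 2 = 4 by ring]
  rfl

/-- The entries of the first row of the design, of length `4u`. -/
def designEntry {k : ℕ} (m u : ℕ) (l₀ : Fin k) (slot : ℕ → Slot k) (t : ℕ) :
    Entry (PauliGroup m) k :=
  if t = 0 then .term (.scalar 0 * .genE 0) l₀
  else if t < u then
    .term (.scalar (slot (t - 1)).exponent * .genE (slot (t - 1)).gate) (slot (t - 1)).var
  else if t = u then .term (.scalar 1 * .genF 0) l₀
  else if t < 2 * u then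
    .term (.scalar (2 - (slot (2 * u - t - 1)).exponent) * .genF (slot (2 * u - t - 1)).gate)
      (slot (2 * u - t - 1)).var
  else if t = 2 * u then .term (.scalar 2 * .genE 0) l₀
  else if t < 3 * u then
    .term (.scalar (slot (t - 2 * u - 1)).exponent * .genF (slot (t - 2 * u - 1)).gate)
      (slot (t - 2 * u - 1)).var
  else if t = 3 * u then .term (.scalar 1 * .genF 0) l₀
  else .term (.scalar (-(slot (4 * u - t - 1)).exponent) * .genE (slot (4 * u - t - 1)).gate)
    (slot (4 * u - t - 1)).var

section designEntry

variable {k m u : ℕ} (l₀ : Fin k) (slot : ℕ → Slot k)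

theorem designEntry_ne_zero (t : ℕ) : designEntry m u l₀ slot t ≠ .zero := by
  unfold designEntry
  split_ifs <;> simp

theorem designEntry_zero : designEntry m u l₀ slot 0 = .term (.scalar 0 * .genE 0) l₀ := if_pos rfl

theorem designEntry_self (hu : 0 < u) :
    designEntry m u l₀ slot u = .term (.scalar 1 * .genF 0) l₀ := by
  unfold designEntry
  rw [if_neg (by omega), if_neg (by omega), if_pos rfl]

theorem designEntry_two_mul (hu : 0 < u) :
    designEntry m u l₀ slot (2 * u) = .term (.scalar 2 * .genE 0) l₀ := by
  unfold designEntry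
  rw [if_neg (by omega), if_neg (by omega), if_neg (by omega), if_neg (by omega), if_pos rfl]

theorem designEntry_three_mul (hu : 0 < u) :
    designEntry m u l₀ slot (3 * u) = .term (.scalar 1 * .genF 0) l₀ := by
  unfold designEntry
  rw [if_neg (by omega), if_neg (by omega), if_neg (by omega), if_neg (by omega),
    if_neg (by omega), if_neg (by omega), if_pos rfl]

theorem designEntry_add_one {j : ℕ} (hj : j + 1 < u) : designEntry m u l₀ slot (j + 1) =
    .term (.scalar (slot j).exponent * .genE (slot j).gate) (slot j).var := by
  unfold designEntry
  rw [if_neg (by omega), if_pos hj, Nat.add_sub_cancel]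

theorem designEntry_two_mul_sub {j : ℕ} (hj : j + 1 < u) :
    designEntry m u l₀ slot (2 * u - (j + 1)) =
      .term (.scalar (2 - (slot j).exponent) * .genF (slot j).gate) (slot j).var := by
  unfold designEntry
  rw [if_neg (by omega), if_neg (by omega), if_neg (by omega), if_pos (by omega),
    show 2 * u - (2 * u - (j + 1)) - 1 = j by omega]

theorem designEntry_two_mul_add {j : ℕ} (hj : j + 1 < u) :
    designEntry m u l₀ slot (2 * u + (j + 1)) =
      .term (.scalar (slot j).exponent * .genF (slot j).gate) (slot j).var := by
  unfold designEntry
  rw [if_neg (by omega), if_neg (by omega), if_neg (by omega), if_neg (by omega),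
    if_neg (by omega), if_pos (by omega), show 2 * u + (j + 1) - 2 * u - 1 = j by omega]

theorem designEntry_four_mul_sub {j : ℕ} (hj : j + 1 < u) :
    designEntry m u l₀ slot (4 * u - (j + 1)) =
      .term (.scalar (-(slot j).exponent) * .genE (slot j).gate) (slot j).var := by
  unfold designEntry
  rw [if_neg (by omega), if_neg (by omega), if_neg (by omega), if_neg (by omega),
    if_neg (by omega), if_neg (by omega), if_neg (by omega),
    show 4 * u - (4 * u - (j + 1)) - 1 = j by omega]

/-- The first row is Hermitian, so the circulant matrix is equal to its adjoint. -/
theorem conj_designEntry (hm : 0 < m) (hslot : ∀ j, (slot j).gate < m) {t : ℕ} (ht : 0 < t)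
    (htu : t < 4 * u) :
    (designEntry m u l₀ slot t).conj = designEntry m u l₀ slot (4 * u - t) := by
  have hu : 0 < u := by omega
  have h12 : (2 : ZMod 4) - 1 = 1 := rfl
  have h22 : -(2 : ZMod 4) = 2 := rfl
  have cases : t = u ∨ t = 2 * u ∨ t = 3 * u ∨ ∃ j, j + 1 < u ∧ (t = j + 1 ∨
      t = 2 * u - (j + 1) ∨ t = 2 * u + (j + 1) ∨ t = 4 * u - (j + 1)) := by
    by_cases h1 : t < u
    · exact .inr (.inr (.inr ⟨t - 1, by omega, by omega⟩))
    by_cases h2 : t < 2 * u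
    · by_cases h : t = u
      · exact .inl h
      · exact .inr (.inr (.inr ⟨2 * u - t - 1, by omega, by omega⟩))
    by_cases h3 : t < 3 * u
    · by_cases h : t = 2 * u
      · exact .inr (.inl h)
      · exact .inr (.inr (.inr ⟨t - 2 * u - 1, by omega, by omega⟩))
    by_cases h : t = 3 * u
    · exact .inr (.inr (.inl h))
    · exact .inr (.inr (.inr ⟨4 * u - t - 1, by omega, by omega⟩))
  rcases cases with rfl | rfl | rfl | ⟨j, hj, rfl | rfl | rfl | rfl⟩
  · rw [show 4 * t - t = 3 * t by omega, designEntry_self _ _ hu, designEntry_three_mul _ _ hu,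
      Entry.conj, PauliGroup.inv_scalar_mul_genF hm, h12]
  · rw [show 4 * u - 2 * u = 2 * u by omega, designEntry_two_mul _ _ hu, Entry.conj,
      PauliGroup.inv_scalar_mul_genE hm, h22]
  · rw [show 4 * u - 3 * u = u by omega, designEntry_self _ _ hu, designEntry_three_mul _ _ hu,
      Entry.conj, PauliGroup.inv_scalar_mul_genF hm, h12]
  · rw [designEntry_add_one _ _ hj, designEntry_four_mul_sub _ _ hj, Entry.conj,
      PauliGroup.inv_scalar_mul_genE (hslot j)]
  · rw [show 4 * u - (2 * u - (j + 1)) = 2 * u + (j + 1) by omega, designEntry_two_mul_add _ _ hj,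
      designEntry_two_mul_sub _ _ hj, Entry.conj, PauliGroup.inv_scalar_mul_genF (hslot j),
      sub_sub_cancel]
  · rw [show 4 * u - (2 * u + (j + 1)) = 2 * u - (j + 1) by omega, designEntry_two_mul_add _ _ hj,
      designEntry_two_mul_sub _ _ hj, Entry.conj, PauliGroup.inv_scalar_mul_genF (hslot j)]
  · rw [show 4 * u - (4 * u - (j + 1)) = j + 1 by omega, designEntry_add_one _ _ hj,
      designEntry_four_mul_sub _ _ hj, Entry.conj, PauliGroup.inv_scalar_mul_genE (hslot j),
      neg_neg]

theorem conj_designEntry_zero (hm : 0 < m) :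
    (designEntry m u l₀ slot 0).conj = designEntry m u l₀ slot 0 := by
  rw [designEntry_zero, Entry.conj, PauliGroup.inv_scalar_mul_genE hm, neg_zero]

end designEntry

/-- The positions `t < 4u` fall into the orbits of `t ↦ -t` and `t ↦ t + 2u` modulo `4u`. -/
theorem sum_range_four_mul {M : Type*} [AddCommMonoid M] (f : ℕ → M) (n : ℕ) :
    ∑ t ∈ Finset.range (4 * (n + 1)), f t =
      f 0 + f (2 * (n + 1)) + (f (n + 1) + f (3 * (n + 1))) + ∑ j ∈ Finset.range n,
        (f (j + 1) + f (4 * (n + 1) - (j + 1)) +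
          (f (2 * (n + 1) + (j + 1)) + f (2 * (n + 1) - (j + 1)))) := by
  have block : ∀ g : ℕ → M, ∑ t ∈ Finset.range (n + 1), g t =
      g 0 + ∑ j ∈ Finset.range n, g (j + 1) := fun g => by
    rw [Finset.sum_range_succ', add_comm]
  have reflect : ∀ g : ℕ → M, ∑ j ∈ Finset.range n, g (j + 1) =
      ∑ j ∈ Finset.range n, g (n + 1 - (j + 1)) := fun g => by
    rw [← Finset.sum_range_reflect]
    refine Finset.sum_congr rfl fun j hj => congrArg g ?_
    have := Finset.mem_range.1 hj
    omega
  rw [show 4 * (n + 1) = (n + 1) + (n + 1) + (n + 1) + (n + 1) by ring, Finset.sum_range_add,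
    Finset.sum_range_add, Finset.sum_range_add, block, block, block, block,
    reflect fun t => f (n + 1 + t), reflect fun t => f (n + 1 + (n + 1) + (n + 1) + t)]
  have e2 : ∀ j ∈ Finset.range n, f (n + 1 + (n + 1 - (j + 1))) = f (2 * (n + 1) - (j + 1)) :=
    fun j hj => congrArg f (by have := Finset.mem_range.1 hj; omega)
  have e4 : ∀ j ∈ Finset.range n, f (n + 1 + (n + 1) + (n + 1) + (n + 1 - (j + 1))) =
      f (n + 1 + (n + 1) + (n + 1) + (n + 1) - (j + 1)) :=
    fun j hj => congrArg f (by have := Finset.mem_range.1 hj; omega)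
  rw [Finset.sum_congr rfl e2, Finset.sum_congr rfl e4]
  simp only [Finset.sum_add_distrib, add_zero, two_mul,
    show 3 * (n + 1) = n + 1 + (n + 1) + (n + 1) by ring]
  abel

section row

variable {N k m : ℕ} [NeZero N]

/-- The imaginary unit of the Pauli group. -/
noncomputable def imagUnit : Subring.center (CircRing N k m) := centralSingle 0 1 1

/-- The cyclic shift by `t`. -/
noncomputable def shift (t : Fin N) : Subring.center (CircRing N k m) := centralSingle t 1 0

/-- The variable `x_l`. -/
noncomputable def varX (l : Fin k) : Subring.center (CircRing N k m) :=
  centralSingle 0 (MvPolynomial.X l) 0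

theorem imagUnit_sq : (imagUnit ^ 2 : Subring.center (CircRing N k m)) = -1 := by
  have h := centralSingle_two_add (N := N) (k := k) (m := m) 0 1 0
  rw [centralSingle_one] at h
  rw [imagUnit, centralSingle_pow, ← h, smul_zero, one_pow]
  rfl

theorem varX_mul_shift_mul_imagUnit (l : Fin k) (t : Fin N) (q : ℕ) :
    (varX l * (shift t * imagUnit ^ q) : Subring.center (CircRing N k m)) =
      centralSingle t (MvPolynomial.X l) q := by
  simp [varX, shift, imagUnit, centralSingle_mul, centralSingle_pow]

theorem varX_mul_shift_mul_neg_imagUnit (l : Fin k) (t : Fin N) (q : ℕ) :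
    (varX l * (shift t * (-imagUnit) ^ q) : Subring.center (CircRing N k m)) =
      centralSingle t (MvPolynomial.X l) (-q) := by
  have h4 : (4 : ZMod 4) = 0 := rfl
  have h : (q : ZMod 4) * (2 + 1) = -q := by linear_combination (q : ZMod 4) * h4
  rw [varX, shift, imagUnit, ← centralSingle_two_add, centralSingle_pow, h]
  simp [centralSingle_mul]

theorem shift_mul_shift (t t' : Fin N) :
    (shift t * shift t' : Subring.center (CircRing N k m)) = shift (t + t') := by
  simp [shift, centralSingle_mul]

theorem shift_pow (t : Fin N) (n : ℕ) :
    (shift t ^ n : Subring.center (CircRing N k m)) = shift (n • t) := by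
  simp [shift, centralSingle_pow]

theorem shift_zero : (shift 0 : Subring.center (CircRing N k m)) = 1 := centralSingle_one

/-- The value of an entry in the signed group ring. -/
noncomputable def entryValue (e : Entry (PauliGroup m) k) : PauliRing k m := e.toRing

/-- A term of a first row: the entry `e` at the position `t`. -/
noncomputable def rowTerm (t : Fin N) (e : Entry (PauliGroup m) k) : CircRing N k m :=
  AddMonoidAlgebra.single t (entryValue e)

theorem rowTerm_term (t : Fin N) (q : ZMod 4) (g : PauliGroup m) (l : Fin k) :
    rowTerm t (.term (.scalar q * g) l) =
      (centralSingle t (MvPolynomial.X l) q : Subring.center (CircRing N k m)) •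
        (atZero g : CircRing N k m) := by
  rw [centralSingle_smul]
  rfl

theorem rowTerm_slotTerm (J t : Fin N) (j : ℕ) (ht : j • (1 : Fin N) = t) (s : Slot k) :
    rowTerm t (.term (.scalar s.exponent * .genE s.gate) s.var) +
      rowTerm (-t) (.term (.scalar (-s.exponent) * .genE s.gate) s.var) +
      (rowTerm (J + t) (.term (.scalar s.exponent * .genF s.gate) s.var) +
        rowTerm (J - t) (.term (.scalar (2 - s.exponent) * .genF s.gate) s.var)) =
      slotTerm (fun j => (atZero (PauliGroup.genE j) : CircRing N k m))
        (fun j => atZero (PauliGroup.genF j)) (imagUnit : Subring.center (CircRing N k m))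
        (shift 1) (shift (-1)) (shift J) varX j s := by
  have ht' : j • (-1 : Fin N) = -t := by rw [smul_neg, ht]
  simp only [rowTerm_term, slotTerm, ← add_smul]
  congr 2
  · rw [mul_add, shift_pow, shift_pow, varX_mul_shift_mul_imagUnit,
      varX_mul_shift_mul_neg_imagUnit, ht, ht']
  · rw [shift_pow, shift_pow, mul_assoc, mul_sub, ← mul_assoc (shift J), ← mul_assoc (shift J),
      mul_sub, shift_mul_shift, shift_mul_shift, varX_mul_shift_mul_imagUnit,
      varX_mul_shift_mul_neg_imagUnit, ht, ht', sub_eq_add_neg _ (centralSingle _ _ _),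
      ← centralSingle_two_add, sub_eq_add_neg, sub_eq_add_neg]

theorem rowTerm_special (J t : Fin N) (l : Fin k) (u : ℕ) (ht : u • (1 : Fin N) = t) :
    rowTerm 0 (.term (.scalar 0 * .genE 0) l) + rowTerm J (.term (.scalar 2 * .genE 0) l) +
      (rowTerm t (.term (.scalar 1 * .genF 0) l) +
        rowTerm (-t) (.term (.scalar 1 * .genF 0) l)) =
      ((varX l * (1 - shift J)) : Subring.center (CircRing N k m)) •
        (atZero (.genE 0) : CircRing N k m) +
      (varX l * (shift 1 ^ u + shift (-1) ^ u) * imagUnit : Subring.center (CircRing N k m)) •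
        (atZero (.genF 0) : CircRing N k m) := by
  have ht' : u • (-1 : Fin N) = -t := by rw [smul_neg, ht]
  simp only [rowTerm_term, ← add_smul]
  congr 2
  · rw [mul_sub, mul_one, sub_eq_add_neg, ← add_zero (2 : ZMod 4), centralSingle_two_add, varX,
      shift, centralSingle_mul, zero_add, mul_one, add_zero]
  · rw [shift_pow, shift_pow, ht, ht', mul_assoc, add_mul, mul_add, ← pow_one imagUnit,
      varX_mul_shift_mul_imagUnit, varX_mul_shift_mul_imagUnit, Nat.cast_one]

end row

/-! ### The design and its degree -/

section circulant

variable {N k m : ℕ} [NeZero N]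

/-- A real polynomial as a central scalar. -/
noncomputable def polyHom : MvPolynomial (Fin k) ℝ →+* Subring.center (CircRing N k m) where
  toFun r := centralSingle 0 r 0
  map_one' := centralSingle_one
  map_mul' r r' := by rw [centralSingle_mul, add_zero, add_zero]
  map_zero' := by
    have h := centralSingle_add (N := N) (k := k) (m := m) 0 0 0 0
    rwa [add_zero, left_eq_add] at h
  map_add' r r' := centralSingle_add 0 r r' 0

/-- The circulant matrix with Hermitian first row `a` is its own adjoint, and its square is
the circulant matrix of the square of `a` in the group ring. -/
theorem circulant_mul_adjoint {a : Fin N → Entry (PauliGroup m) k}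
    (ha : ∀ t, (a t).conj = a (-t)) {p : MvPolynomial (Fin k) ℝ}
    (h : (∑ t, rowTerm t (a t)) * (∑ t, rowTerm t (a t)) =
      ((polyHom p : Subring.center (CircRing N k m)) : CircRing N k m)) :
    (Matrix.of fun i j => a (j - i)).map Entry.toRing *
      (adjoint (Matrix.of fun i j => a (j - i))).map Entry.toRing =
        Matrix.diagonal fun _ => monom p 1 := by
  have hcoeff : ∀ d : Fin N, ∑ s, entryValue (a s) * entryValue (a (d - s)) =
      if d = 0 then pauliMonom p 1 else 0 := by
    intro d
    have h' := congrArg (fun y : CircRing N k m => y.coeff d) h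
    simp only [Finset.sum_mul_sum, rowTerm, AddMonoidAlgebra.single_mul_single,
      AddMonoidAlgebra.coeff_sum, Finsupp.finsetSum_apply, AddMonoidAlgebra.coeff_single,
      Finsupp.single_apply] at h'
    have h2 : (((polyHom p : Subring.center (CircRing N k m)) : CircRing N k m)).coeff d =
        if d = 0 then pauliMonom p 1 else 0 := by
      change (AddMonoidAlgebra.single (0 : Fin N) (pauliMonom p (PauliGroup.scalar 0))).coeff d = _
      rw [AddMonoidAlgebra.coeff_single, Finsupp.single_apply, PauliGroup.scalar_zero]
      simp only [eq_comm]
    rw [h2] at h'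
    rw [← h']
    refine Finset.sum_congr rfl fun s _ => ?_
    rw [Finset.sum_eq_single (d - s)]
    · rw [if_pos (by abel)]
    · intro t _ ht
      rw [if_neg fun e => ht (by rw [← e]; abel)]
    · simp
  ext i j
  have hentry : ((Matrix.of fun i j => a (j - i)).map Entry.toRing *
      (adjoint (Matrix.of fun i j => a (j - i))).map Entry.toRing) i j =
      ∑ s, ((a s).toRing : SignedGroupRing (MvPolynomial (Fin k) ℝ) (PauliGroup m)) *
        (a (j - i - s)).toRing := by
    rw [Matrix.mul_apply]
    refine Fintype.sum_equiv (Equiv.subRight i) _ _ fun t => ?_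
    simp only [Matrix.map_apply, adjoint, Matrix.transpose_apply, Matrix.of_apply, ha,
      Equiv.subRight_apply]
    congr 3
    abel
  rw [hentry, Matrix.diagonal_apply]
  refine (hcoeff (j - i)).trans ?_
  by_cases hij : i = j
  · rw [if_pos (by rw [hij, sub_self]), if_pos hij]
    rfl
  · rw [if_neg fun e => hij (sub_eq_zero.1 e).symm, if_neg hij]
    rfl

open Fin.CommRing in
theorem Fin.val_nsmul_one (t : Fin N) : (t : ℕ) • (1 : Fin N) = t := by
  rw [nsmul_one, Fin.cast_val_eq_self]

theorem sum_rowTerm_designEntry (u : ℕ) (hN : N = 4 * (u + 1)) (l₀ : Fin k)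
    (D : List (Fin k × List ℕ)) (hD : (D.map fun d => d.2.length).sum = u) :
    ∑ t : Fin N, rowTerm t (designEntry m (u + 1) l₀
      (fun j => (slotList 1 D).getD j ⟨0, 0, l₀⟩) (t : ℕ)) =
      ((varX l₀ * (1 - shift ((2 * (u + 1)) • 1))) : Subring.center (CircRing N k m)) •
        (atZero (.genE 0) : CircRing N k m) +
      (varX l₀ * (shift 1 ^ (u + 1) + shift (-1) ^ (u + 1)) * imagUnit :
        Subring.center (CircRing N k m)) • (atZero (.genF 0) : CircRing N k m) +
      slotSum (fun j => (atZero (.genE j) : CircRing N k m)) (fun j => atZero (.genF j))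
        (imagUnit : Subring.center (CircRing N k m)) (shift 1) (shift (-1))
        (shift ((2 * (u + 1)) • 1)) varX 1 (slotList 1 D) := by
  set slot : ℕ → Slot k := fun j => (slotList 1 D).getD j ⟨0, 0, l₀⟩ with hslot
  have hN0 : (4 * (u + 1)) • (1 : Fin N) = 0 := by
    have h := card_nsmul_eq_zero' (G := Fin N) (x := 1)
    rw [Nat.card_eq_fintype_card, Fintype.card_fin] at h
    rwa [← hN]
  have e1 : ∑ t : Fin N, rowTerm t (designEntry m (u + 1) l₀ slot (t : ℕ)) =
      ∑ t ∈ Finset.range (4 * (u + 1)), rowTerm (t • (1 : Fin N))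
        (designEntry m (u + 1) l₀ slot t) := by
    rw [← hN, ← Fin.sum_univ_eq_sum_range
      (fun t => rowTerm (t • (1 : Fin N)) (designEntry m (u + 1) l₀ slot t)) N]
    simp only [Fin.val_nsmul_one]
  have sub_nsmul : ∀ {s t : ℕ}, t ≤ s → (s - t) • (1 : Fin N) = s • 1 - t • 1 := fun h => by
    rw [eq_sub_iff_add_eq, ← add_nsmul, Nat.sub_add_cancel h]
  have h3 : (3 * (u + 1)) • (1 : Fin N) = -((u + 1) • 1) := by
    rw [← zero_sub, ← hN0, ← sub_nsmul (by omega)]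
    congr 1
    omega
  rw [e1, sum_range_four_mul, zero_smul, h3, designEntry_zero, designEntry_self _ _ (by omega),
    designEntry_two_mul _ _ (by omega), designEntry_three_mul _ _ (by omega),
    rowTerm_special _ _ l₀ (u + 1) rfl, slotSum_eq_sum_range _ _ _ _ _ _ _ _ _ ⟨0, 0, l₀⟩,
    length_slotList, hD]
  congr 1
  refine Finset.sum_congr rfl fun j hj => ?_
  have hj' : j + 1 < u + 1 := by
    have := Finset.mem_range.1 hj
    omega
  rw [designEntry_add_one _ _ hj', designEntry_four_mul_sub _ _ hj',
    designEntry_two_mul_add _ _ hj', designEntry_two_mul_sub _ _ hj', sub_nsmul (by omega),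
    sub_nsmul (by omega), hN0, zero_sub, add_nsmul (1 : Fin N) (2 * (u + 1)) (j + 1), add_comm 1 j]
  exact rowTerm_slotTerm _ _ (j + 1) rfl (slot j)

/-- A list of sequences with total length `u`, each attached to a variable, gives a full circulant
quasisymmetric design of order `4 (u + 1)`, as soon as the autocorrelations, weighted by the squares
of the variables, add up to a constant. -/
theorem exists_design {u n : ℕ} (hn : n = 4 * (u + 1)) (l₀ : Fin k) (D : List (Fin k × List ℕ))
    (hD : (D.map fun d => d.2.length).sum = u) (w : Fin k → ℕ) (hw : ∀ l, 0 < w l)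
    (hnorm : ∀ {K : Type} [CommRing K] (I z z' : K) (x : Fin k → K), I ^ 2 = -1 → z * z' = 1 →
      4 * (x l₀ ^ 2 + (D.map fun d =>
        x d.1 ^ 2 * (seqEval I z d.2 * seqEval (-I) z' d.2)).sum) = ∑ l, (w l : K) * x l ^ 2) :
    ∃ X : Matrix (Fin n) (Fin n) (Entry (PauliGroup (1 + D.length)) k),
      IsSOD X w ∧ IsFull X ∧ IsCirculant X ∧ IsQuasisymmetric X := by
  have : NeZero n := ⟨by omega⟩
  set m := 1 + D.length with hm
  set slot : ℕ → Slot k := fun j => (slotList 1 D).getD j ⟨0, 0, l₀⟩ with hslot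
  have hgate : ∀ j, (slot j).gate < m := by
    intro j
    rcases lt_or_ge j (slotList 1 D).length with hj | hj
    · rw [hslot]
      simp only [List.getD_eq_getElem _ _ hj]
      exact gate_lt_of_mem_slotList (List.getElem_mem hj)
    · rw [hslot]
      simp only [List.getD_eq_default _ _ hj]
      omega
  set a : Fin n → Entry (PauliGroup m) k := fun t => designEntry m (u + 1) l₀ slot t with ha
  have hconj : ∀ t, (a t).conj = a (-t) := by
    intro t
    rcases Nat.eq_zero_or_pos (t : ℕ) with ht | ht
    · have h0 : t = 0 := Fin.ext ht
      rw [h0, neg_zero]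
      simp only [ha, Fin.val_zero]
      exact conj_designEntry_zero l₀ slot (by omega)
    · have hneg : ((-t : Fin n) : ℕ) = 4 * (u + 1) - t := by
        rw [Fin.val_neg', Nat.mod_eq_of_lt (by omega)]
        omega
      simp only [ha, hneg]
      exact conj_designEntry l₀ slot (by omega) hgate ht (by omega)
  have hN0 : (4 * (u + 1)) • (1 : Fin n) = 0 := by
    have h := card_nsmul_eq_zero' (G := Fin n) (x := 1)
    rw [Nat.card_eq_fintype_card, Fintype.card_fin] at h
    rwa [← hn]
  have hsq : (∑ t, rowTerm t (a t)) * (∑ t, rowTerm t (a t)) =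
      ((polyHom (∑ l, (w l : MvPolynomial (Fin k) ℝ) * MvPolynomial.X l ^ 2) :
        Subring.center (CircRing n k m)) : CircRing n k m) := by
    rw [ha, sum_rowTerm_designEntry u hn l₀ D hD]
    have hzw : (shift 1 * shift (-1) : Subring.center (CircRing n k m)) = 1 := by
      rw [shift_mul_shift, add_neg_cancel, shift_zero]
    have hz : (shift 1 ^ (u + 1) * shift 1 ^ (u + 1) : Subring.center (CircRing n k m)) =
        shift ((2 * (u + 1)) • 1) := by
      rw [← pow_add, ← two_mul, shift_pow]
    have hw' : (shift (-1) ^ (u + 1) * shift (-1) ^ (u + 1) : Subring.center (CircRing n k m)) =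
        shift ((2 * (u + 1)) • 1) := by
      rw [← pow_add, ← two_mul, shift_pow, smul_neg, neg_eq_iff_add_eq_zero.2]
      rw [← add_nsmul, ← hN0]
      congr 1
      ring
    rw [add_slotSum_sq isCliffordSystem_atZero imagUnit_sq hzw hz hw' varX (varX l₀) D hm.ge,
      hnorm _ _ _ _ imagUnit_sq hzw]
    have hpoly : (∑ l, (w l : Subring.center (CircRing n k m)) * varX l ^ 2) =
        polyHom (∑ l, (w l : MvPolynomial (Fin k) ℝ) * MvPolynomial.X l ^ 2) := by
      simp only [map_sum, map_mul, map_natCast, map_pow]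
      rfl
    rw [hpoly]
    rfl
  refine ⟨Matrix.of fun i j => a (j - i), ⟨hw, circulant_mul_adjoint hconj hsq⟩,
    fun i j => designEntry_ne_zero l₀ slot _, ⟨a, fun i j => rfl⟩, ?_⟩
  ext i j
  simp only [Matrix.map_apply, adjoint, Matrix.transpose_apply, Matrix.of_apply, hconj, neg_sub]

end circulant

theorem mainTheorem5 (k : ℕ) [NeZero k] (u : Fin k → ℕ) (hu : ∀ i, 0 < u i) :
    ∃ (S : Type) (_ : SignedGroup S)
      (X : Matrix (Fin (4 * ∑ i, u i)) (Fin (4 * ∑ i, u i)) (SignedGroup.Entry S k)) (n : ℕ),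
      SignedGroup.IsSOD X (fun i => 4 * u i) ∧
      SignedGroup.IsFull X ∧
      SignedGroup.IsCirculant X ∧
      SignedGroup.IsQuasisymmetric X ∧
      Nonempty (SignedGroup.Remrep S (2 ^ n)) ∧
      (n : ℝ) ≤ (3 / 13) * Real.logb 2 ((u 0 : ℝ) - 1) +
        (3 / 13) * ∑ i ∈ Finset.univ.erase (0 : Fin k), Real.logb 2 (u i : ℝ) + 8 * (k : ℝ) + 2 := by
  -- One unit of `u 0` is used up by the four exceptional positions.
  let v : Fin k → ℕ := fun i => if i = 0 then u 0 - 1 else u i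
  have hv0 : v 0 + 1 = u 0 := by
    have := hu 0
    simp only [v, if_true]
    omega
  have hv : ∀ i ∈ Finset.univ.erase (0 : Fin k), v i = u i := fun i hi =>
    if_neg (Finset.ne_of_mem_erase hi)
  choose F hF hFlen using fun i => exists_isComplementary (v i)
  let D : List (Fin k × List ℕ) := (List.finRange k).flatMap fun i => (F i).map fun a => (i, a)
  have hsum : ∀ {M : Type} [AddCommMonoid M] (f : Fin k × List ℕ → M),
      (D.map f).sum = ∑ i, ((F i).map fun a => f (i, a)).sum := by
    intro M _ f
    rw [Fin.sum_univ_def]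
    simp only [D]
    induction List.finRange k with
    | nil => simp
    | cons i L ih =>
      simp only [List.flatMap_cons, List.map_append, List.sum_append, List.map_cons,
        List.sum_cons, ih, List.map_map]
      rfl
  have hlen : (D.map fun d => d.2.length).sum = ∑ i, v i := by
    rw [hsum]
    exact Finset.sum_congr rfl fun i _ => (hF i).sum_length
  have hcard : D.length = ∑ i, (F i).length := by
    have h := hsum fun _ => 1
    simpa using h
  have huv : ∑ i, u i = ∑ i, v i + 1 := by
    have e1 : u 0 + ∑ i ∈ Finset.univ.erase (0 : Fin k), u i = ∑ i, u i :=
      Finset.add_sum_erase _ _ (Finset.mem_univ _)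
    have e2 : v 0 + ∑ i ∈ Finset.univ.erase (0 : Fin k), v i = ∑ i, v i :=
      Finset.add_sum_erase _ _ (Finset.mem_univ _)
    have e3 : ∑ i ∈ Finset.univ.erase (0 : Fin k), v i =
      ∑ i ∈ Finset.univ.erase (0 : Fin k), u i := Finset.sum_congr rfl hv
    omega
  obtain ⟨X, h1, h2, h3, h4⟩ := exists_design (n := 4 * ∑ i, u i) (by rw [huv]) 0 D hlen
    (fun i => 4 * u i) (fun i => by have := hu i; positivity) (by
      intro K _ I z z' x hI hz
      rw [hsum]
      have hi : ∀ i, ((F i).map fun a => x i ^ 2 * (seqEval I z a * seqEval (-I) z' a)).sum =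
          (v i : K) * x i ^ 2 := by
        intro i
        rw [List.sum_map_mul_left, (hF i).sum_norm I z z' hI hz, mul_comm]
      simp only [hi]
      rw [← Finset.add_sum_erase _ _ (Finset.mem_univ (0 : Fin k)),
        ← Finset.add_sum_erase _ (fun i => ((4 * u i : ℕ) : K) * x i ^ 2)
          (Finset.mem_univ (0 : Fin k)), ← hv0, mul_add, mul_add, Finset.mul_sum]
      have : ∑ i ∈ Finset.univ.erase (0 : Fin k), 4 * ((v i : K) * x i ^ 2) =
          ∑ i ∈ Finset.univ.erase (0 : Fin k), ((4 * u i : ℕ) : K) * x i ^ 2 :=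
        Finset.sum_congr rfl fun i hi => by rw [← hv i hi]; push_cast; ring
      rw [this]
      push_cast
      ring)
  refine ⟨PauliGroup (1 + D.length), inferInstance, X, 1 + D.length + 1, h1, h2, h3, h4,
    PauliGroup.nonempty_remrep _, ?_⟩
  have hb : ((∑ i, (F i).length : ℕ) : ℝ) ≤ ∑ i, (3 / 13 * Real.logb 2 (v i) + 8) := by
    push_cast
    exact Finset.sum_le_sum fun i _ => hFlen i
  have hv0' : (v 0 : ℝ) = (u 0 : ℝ) - 1 := by
    rw [← hv0]
    push_cast
    ring
  have e1 : Real.logb 2 (v 0) + ∑ i ∈ Finset.univ.erase (0 : Fin k), Real.logb 2 (v i) =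
      ∑ i, Real.logb 2 (v i) :=
    Finset.add_sum_erase _ (fun i => Real.logb 2 (v i)) (Finset.mem_univ _)
  have e2 : ∑ i ∈ Finset.univ.erase (0 : Fin k), Real.logb 2 (v i) =
      ∑ i ∈ Finset.univ.erase (0 : Fin k), Real.logb 2 (u i) :=
    Finset.sum_congr rfl fun i hi => by rw [hv i hi]
  rw [Finset.sum_add_distrib, ← Finset.mul_sum, ← e1, e2, hv0'] at hb
  simp only [Finset.sum_const, Finset.card_univ, Fintype.card_fin, nsmul_eq_mul] at hb
  rw [hcard]
  push_cast at hb ⊢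
  linarith
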